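/- **Kertz constant and the ODE.** There is exactly one $\beta\in(0,1)$ with $$\int_0^1\bigl[(\beta^{-1}-1)-y(\log y-1)\bigr]^{-1}\,dy=1 ,$$ and for this $\beta$ there is a differentiable function $y:[0,1]\to[0,1]$, with $\log y$ integrable on $[0,1]$, such that $$\exp\Bigl(\int_0^t\log y(s)\,ds\Bigr)=-\beta\,y'(t)\quad(0\le t\le 1),\qquad y(0)=1,\qquad y(1)=0. \tag{1}$$ **The distributions.** Let $y$ be any such solution of (1). For $q\in(0,1)$ put $p=y(q)$ and $$H=\frac{1}{y'(q)\log p}-\int_q^1\frac{dt}{y'(t)},\qquad r^*(t)=-\int_t^1\frac{ds}{y'(s)}\ \ (q\le t\le 1),\qquad r^*(t)=H\ \ (0\le t<q),$$ and let $$F_q(x)=\begin{cases}0,&x<0,\\ y\bigl((r^*)^{-1}(x)\bigr),&0\le x\le r^*(q),\\ p,&r^*(q)<x<H,\\ 1,&x\ge H,\end{cases}$$ where $(r^*)^{-1}$ denotes the inverse of $r^*$ restricted to $[q,1]$. **The selection problem.** For independent nonnegative random variables $X_1,\dots,X_n$ with known distributions, let $\mathsf{MAX}=\mathbb E[\max_i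 X_i]$, and let $\mathsf{OPT}$ be the supremum of the expected rewards of online policies: the variables are revealed one at a time in uniformly random order (identity and value), and after each one the policy irrevocably decides, on the basis of what it has seen so far, whether to stop with that value as its reward (the reward is $0$ if it never stops). **Theorem.** For every $q\in(0,1)$ and $n\ge 1$, the function $F_q^{1/n}$ is the c.d.f. of a probability distribution. For $n$ i.i.d. variables with this distribution, $\mathsf{MAX}$ is finite, positive and independent of $n$; call it $\mathsf{MAX}_q$. The value $\mathsf{OPT}$ of this instance converges, as $n\to\infty$, to a finite limit $\mathsf{OPT}_q$. Moreover $$\lim_{q\to0^+}\frac{\mathsf{OPT}_q}{\mathsf{MAX}_q}=\beta .$$ -/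

import Mathlib

open Set Filter Topology MeasureTheory

namespace Prophet

noncomputable section

/-! ### The online selection problem: boxes arriving in uniformly random order -/

/-- An online policy for `n` boxes with known distributions. The sample point is a pair `(π, x)`:
`π k` is the box that arrives at step `k`, and `x i` is the value inside box `i`. The policy stops
at step `τ π x`, or never if `τ π x = none`. Whether it stops at step `k` depends only on the
identities and the values of the boxes seen at steps `0, …, k`. -/
structure Policy (n : ℕ) where
  τ : Equiv.Perm (Fin n) → (Fin n → ℝ) → Option (Fin n)
  measurableSet_stop : ∀ π k, MeasurableSet {x | τ π x = some k}
  nonanticipating : ∀ (k : Fin n) (π π' : Equiv.Perm (Fin n)) (x x' : Fin n → ℝ),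
    (∀ j ≤ k, π j = π' j ∧ x (π j) = x' (π' j)) → τ π x = some k → τ π' x' = some k

/-- The value of the box that the policy selects; it is `0` if no box is selected. -/
def Policy.reward {n : ℕ} (T : Policy n) (π : Equiv.Perm (Fin n)) (x : Fin n → ℝ) : ℝ :=
  (T.τ π x).elim 0 (fun k => x (π k))

/-- Expected reward of a policy: the values are independent, nonnegative, with laws `ν i`, and
the order of arrival is uniformly random and independent of the values. -/
def Policy.value {n : ℕ} (T : Policy n) (ν : Fin n → Measure ℝ) : ENNReal :=
  (∑ π : Equiv.Perm (Fin n), ∫⁻ x, ENNReal.ofReal (T.reward π x) ∂(Measure.pi ν)) /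
    (Fintype.card (Equiv.Perm (Fin n)) : ENNReal)

/-- `OPT`: the reward of an optimal policy. -/
def opt {n : ℕ} (ν : Fin n → Measure ℝ) : ENNReal :=
  ⨆ T : Policy n, T.value ν

/-- `MAX`: the expectation of the maximum of independent nonnegative variables with laws `ν i`. -/
def prophetMax {n : ℕ} (ν : Fin n → Measure ℝ) : ENNReal :=
  ∫⁻ x, (⨆ i, ENNReal.ofReal (x i)) ∂(Measure.pi ν)

open Classical in
/-- The measure on `ℝ` with cumulative distribution function `G`
(the Lebesgue–Stieltjes measure of `G`). -/
def lawOfCdf (G : ℝ → ℝ) : Measure ℝ :=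
  if h : Monotone G then h.stieltjesFunction.measure else 0

/-! ### The Kertz constant and the differential equation -/

/-- `β ∈ (0, 1)` solves `∫₀¹ [(β⁻¹ - 1) - y (log y - 1)]⁻¹ dy = 1`. -/
def IsKertzConstant (β : ℝ) : Prop :=
  0 < β ∧ β < 1 ∧ ∫ y in (0 : ℝ)..1, ((β⁻¹ - 1) - y * (Real.log y - 1))⁻¹ = 1

/-- The derivative of a function on `[0, 1]` (one-sided at the endpoints). -/
def D (y : ℝ → ℝ) (t : ℝ) : ℝ := derivWithin y (Icc 0 1) t

/-- `y : [0, 1] → [0, 1]` is differentiable, satisfies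
`exp (∫₀ᵗ log y(s) ds) = -β y'(t)` on `[0, 1]`, and `y(0) = 1`, `y(1) = 0`. -/
structure IsSolution (β : ℝ) (y : ℝ → ℝ) : Prop where
  mapsTo : MapsTo y (Icc 0 1) (Icc 0 1)
  differentiableOn : DifferentiableOn ℝ y (Icc 0 1)
  intervalIntegrable_log : IntervalIntegrable (fun s => Real.log (y s)) volume 0 1
  equation : ∀ t ∈ Icc (0 : ℝ) 1, Real.exp (∫ s in (0 : ℝ)..t, Real.log (y s)) = -β * D y t
  zero : y 0 = 1
  one : y 1 = 0

/-! ### The distribution `F_q` -/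

/-- `H = 1 / (y'(q) log p) - ∫_q^1 1 / y'(t) dt` where `p = y(q)`. -/
def H (y : ℝ → ℝ) (q : ℝ) : ℝ :=
  1 / (D y q * Real.log (y q)) - ∫ t in q..1, 1 / D y t

/-- `r*(t) = -∫_t^1 1 / y'(s) ds` for `t ∈ [q, 1]` and `r*(t) = H` for `t ∈ [0, q)`. -/
def rStar (y : ℝ → ℝ) (q t : ℝ) : ℝ :=
  if q ≤ t then -∫ s in t..1, 1 / D y s else H y q

/-- The c.d.f. `F_q`: it is `0` on `(-∞, 0)`, `y ((r*)⁻¹ x)` on `[0, r*(q)]`, `p = y(q)` on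
`(r*(q), H)` and `1` on `[H, ∞)`. The inverse is that of the decreasing branch of `r*`, which
maps `[q, 1]` onto `[0, r*(q)]`. -/
def F (y : ℝ → ℝ) (q x : ℝ) : ℝ :=
  if x < 0 then 0
  else if x ≤ rStar y q q then y (Function.invFunOn (rStar y q) (Icc q 1) x)
  else if x < H y q then y q
  else 1

/-- The law with c.d.f. `F_q^{1/n}`. -/
def law (y : ℝ → ℝ) (q : ℝ) (n : ℕ) : Measure ℝ :=
  lawOfCdf (fun x => F y q x ^ (1 / (n : ℝ)))

end

end Prophet

/-! For i.i.d. boxes the order of arrival is irrelevant, and `OPT` is the value `V_n` of the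
backward recursion `V_{k+1} = E[max(X, V_k)]`, `V_0 = 0`. By the layer cake formula one step adds
`∫_V^H (1 - F^{1/n})`. Since `n (1 - F^{1/n}) → -log F`, the recursion is an Euler scheme with step
`1/n` for `v' = ∫_v^H (-log F)`, `v(0) = 0`, and `OPT` tends to `v(1)`. Each step is nonexpansive in
`V`, so local errors only add up (`abs_dpSeq_sub_path_le`).

The distribution is built so that this limit equation is solvable in closed form. Write `σ = -y'`
and `r(t) = ∫_t^1 1/σ`. Differentiating (1) gives `σ' = σ log y`, hence `(1/σ)' = -(log y)/σ`. As
`F(r(t)) = y(t)`, the substitution `x = r(t)`, together with the choice of `H`, yields `∫_{r(t)}^H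
(-log F) = 1/σ(t) = -r'(t)` on `[q, 1]` (`integral_neg_log_F`). So `v(s) = r(1 - s)` until `s = 1 -
q`; afterwards `F` is constant up to `H` and `v` solves a linear equation. As `q → 0`, `v(1) →
r(0)`.

The maximum of the `n` boxes has c.d.f. `F_q` for every `n`, so `MAX` is `∫_0^H (1 - F_q)`. The
first integral `σ = (β⁻¹ - 1) - y (log y - 1)` makes this elementary (`integral_one_sub_F`). Its
limit is `r(0)/β - β + β`, the last term coming from the escaping atom at `H`. The quotient of the
limits is `β`.

The same first integral turns (1) into a separable equation, and Kertz's condition says that `y`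
descends from 1 to 0 in time exactly 1. -/

namespace Prophet

noncomputable section

/-! ### Existence and uniqueness of the Kertz constant -/

theorem mul_log_sub_one_nonpos {y : ℝ} (h0 : 0 ≤ y) (h1 : y ≤ 1) : y * (Real.log y - 1) ≤ 0 :=
  mul_nonpos_of_nonneg_of_nonpos h0 (by linarith [Real.log_nonpos h0 h1])

theorem neg_one_le_mul_log_sub_one {y : ℝ} (h0 : 0 ≤ y) : -1 ≤ y * (Real.log y - 1) := by
  rcases h0.eq_or_lt with rfl | h0
  · norm_num
  · have h := mul_le_mul_of_nonneg_left (Real.one_sub_inv_le_log_of_pos h0) h0.le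
    have h2 : y * (1 - y⁻¹) = y - 1 := by field_simp
    linarith

/-- Projection of the real line to `[0, 1]`. -/
def clamp (y : ℝ) : ℝ := max 0 (min y 1)

theorem clamp_nonneg (y : ℝ) : 0 ≤ clamp y := le_max_left _ _

theorem clamp_le_one (y : ℝ) : clamp y ≤ 1 := max_le zero_le_one (min_le_right _ _)

theorem clamp_of_mem {y : ℝ} (hy : y ∈ Icc (0 : ℝ) 1) : clamp y = y := by
  rw [clamp, min_eq_left hy.2, max_eq_right hy.1]

theorem continuous_clamp : Continuous clamp := by unfold clamp; fun_prop

/-- `c - y (log y - 1)`, the denominator in Kertz's integral, extended constantly outside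
of `[0, 1]`. -/
def kertzDen (c y : ℝ) : ℝ := c - clamp y * (Real.log (clamp y) - 1)

theorem kertzDen_of_mem (c : ℝ) {y : ℝ} (hy : y ∈ Icc (0 : ℝ) 1) :
    kertzDen c y = c - y * (Real.log y - 1) := by rw [kertzDen, clamp_of_mem hy]

theorem le_kertzDen (c y : ℝ) : c ≤ kertzDen c y := by
  have := mul_log_sub_one_nonpos (clamp_nonneg y) (clamp_le_one y)
  unfold kertzDen; linarith

theorem kertzDen_le (c y : ℝ) : kertzDen c y ≤ c + 1 := by
  have := neg_one_le_mul_log_sub_one (clamp_nonneg y)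
  unfold kertzDen; linarith

theorem continuous_mul_log_sub_one : Continuous fun y : ℝ => y * (Real.log y - 1) := by
  have : (fun y : ℝ => y * (Real.log y - 1)) = fun y => y * Real.log y - y := by
    ext y; ring
  rw [this]
  exact Real.continuous_mul_log.sub continuous_id

theorem continuous_kertzDen_uncurry : Continuous fun p : ℝ × ℝ => kertzDen p.1 p.2 := by
  unfold kertzDen
  exact continuous_fst.sub (continuous_mul_log_sub_one.comp (continuous_clamp.comp continuous_snd))

theorem continuous_kertzDen (c : ℝ) : Continuous (kertzDen c) :=
  continuous_kertzDen_uncurry.comp (by fun_prop : Continuous fun y : ℝ => (c, y))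

theorem continuous_inv_kertzDen {c : ℝ} (hc : 0 < c) : Continuous fun y => (kertzDen c y)⁻¹ :=
  (continuous_kertzDen c).inv₀ fun y => (hc.trans_le (le_kertzDen c y)).ne'

/-- Kertz's integral as a function of `c = β⁻¹ - 1`. -/
def kertzIntegral (c : ℝ) : ℝ := ∫ y in (0 : ℝ)..1, (kertzDen c y)⁻¹

theorem integral_eq_kertzIntegral (c : ℝ) :
    ∫ y in (0 : ℝ)..1, (c - y * (Real.log y - 1))⁻¹ = kertzIntegral c := by
  refine intervalIntegral.integral_congr fun y hy => ?_
  rw [uIcc_of_le zero_le_one] at hy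
  simp only [kertzDen_of_mem c hy]

theorem kertzIntegral_strictAntiOn : StrictAntiOn kertzIntegral (Ioi 0) := by
  intro a ha b hb hab
  have ha' : 0 < a := ha
  have hb' : 0 < b := hb
  have key : ∀ y, (kertzDen b y)⁻¹ < (kertzDen a y)⁻¹ := fun y =>
    inv_strictAnti₀ (ha'.trans_le (le_kertzDen a y)) (by unfold kertzDen; linarith)
  exact intervalIntegral.integral_lt_integral_of_continuousOn_of_le_of_exists_lt zero_lt_one
    (continuous_inv_kertzDen hb').continuousOn (continuous_inv_kertzDen ha').continuousOn
    (fun y _ => (key y).le) ⟨0, by simp, key 0⟩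

theorem continuousOn_kertzIntegral : ContinuousOn kertzIntegral (Icc (1 / 10) 1) := by
  -- Replacing `c` by `max c (1/10)` keeps the denominator away from 0 for all real `c`, so
  -- continuity can be proved globally.
  have h : Continuous fun c : ℝ => ∫ y in (0 : ℝ)..1, (kertzDen (max c (1 / 10)) y)⁻¹ := by
    refine intervalIntegral.continuous_parametric_intervalIntegral_of_continuous' ?_ _ _
    refine Continuous.inv₀ (f := fun p : ℝ × ℝ => kertzDen (max p.1 (1 / 10)) p.2)
      (continuous_kertzDen_uncurry.comp
        (by fun_prop : Continuous fun p : ℝ × ℝ => (max p.1 (1 / 10), p.2))) ?_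
    rintro ⟨c, y⟩
    exact (lt_of_lt_of_le (by positivity) (le_kertzDen (max c (1 / 10)) y)).ne'
  refine h.continuousOn.congr fun c hc => ?_
  simp only [kertzIntegral, max_eq_left hc.1]

theorem kertzIntegral_one_le : kertzIntegral 1 ≤ 1 := by
  have h : kertzIntegral 1 ≤ ∫ _ in (0 : ℝ)..1, (1 : ℝ) := by
    refine intervalIntegral.integral_mono_on zero_le_one
      ((continuous_inv_kertzDen one_pos).intervalIntegrable _ _) (by simp) fun y _ => ?_
    exact inv_le_one_of_one_le₀ (le_kertzDen 1 y)
  simpa using h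

/-- Two tangent-line bounds suffice: `z⁻¹ ≥ 2 - z` at `z = 1`, and convexity of `y log y` at `y =
1/2`. They leave the linear minorant `7/5 - y log 2`, whose integral is about 1.05. -/
theorem one_le_kertzIntegral : 1 ≤ kertzIntegral (1 / 10) := by
  have hc : (0 : ℝ) < 1 / 10 := by norm_num
  have h : ∫ y in (0 : ℝ)..1, (7 / 5 - y * Real.log 2) ≤ kertzIntegral (1 / 10) := by
    refine intervalIntegral.integral_mono_on zero_le_one
      ((by fun_prop : Continuous fun y : ℝ => 7 / 5 - y * Real.log 2).intervalIntegrable _ _)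
      ((continuous_inv_kertzDen hc).intervalIntegrable _ _) fun y hy => ?_
    have hpos := hc.trans_le (le_kertzDen (1 / 10) y)
    have h1 : 2 - kertzDen (1 / 10) y ≤ (kertzDen (1 / 10) y)⁻¹ := by
      rw [← sub_nonneg]
      have : (kertzDen (1 / 10) y)⁻¹ - (2 - kertzDen (1 / 10) y) =
          (kertzDen (1 / 10) y - 1) ^ 2 / kertzDen (1 / 10) y := by field_simp; ring
      rw [this]; positivity
    refine le_trans ?_ h1
    rw [kertzDen_of_mem _ hy]
    rcases hy.1.eq_or_lt with h0 | h0
    · rw [← h0]; norm_num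
    · have h2 := neg_one_le_mul_log_sub_one (y := 2 * y) (by linarith)
      rw [Real.log_mul two_ne_zero h0.ne'] at h2
      nlinarith
  have h2 : ∫ y in (0 : ℝ)..1, (7 / 5 - y * Real.log 2) = 7 / 5 - Real.log 2 / 2 := by
    rw [intervalIntegral.integral_sub (by simp)
      ((by fun_prop : Continuous fun y : ℝ => y * Real.log 2).intervalIntegrable _ _),
      intervalIntegral.integral_mul_const, integral_id]
    norm_num
    ring
  have := Real.log_two_lt_d9
  linarith

theorem isKertzConstant_iff {β : ℝ} :
    IsKertzConstant β ↔ 0 < β ∧ β < 1 ∧ kertzIntegral (β⁻¹ - 1) = 1 := by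
  rw [IsKertzConstant, integral_eq_kertzIntegral]

theorem IsKertzConstant.sub_pos {β : ℝ} (h : IsKertzConstant β) : 0 < β⁻¹ - 1 := by
  have := (one_lt_inv₀ h.1).2 h.2.1
  linarith

theorem existsUnique_isKertzConstant : ∃! β : ℝ, IsKertzConstant β := by
  obtain ⟨c, hc, hc1⟩ := intermediate_value_Icc' (by norm_num : (1 / 10 : ℝ) ≤ 1)
    continuousOn_kertzIntegral ⟨kertzIntegral_one_le, one_le_kertzIntegral⟩
  have hc0 : 0 < c := by linarith [hc.1]
  refine ⟨(c + 1)⁻¹, isKertzConstant_iff.2 ⟨by positivity, inv_lt_one_of_one_lt₀ (by linarith), ?_⟩,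
    fun β hβ => ?_⟩
  · rw [inv_inv, add_sub_cancel_right, hc1]
  · have h := (isKertzConstant_iff.1 hβ).2.2
    have := kertzIntegral_strictAntiOn.injOn hβ.sub_pos hc0 (h.trans hc1.symm)
    rw [← this, sub_add_cancel, inv_inv]

/-! ### Existence of a solution of the differential equation -/

/-- The inverse of `u ↦ ∫₀ᵘ dy / f(y)` solves the autonomous differential equation `R' = f(R)`. -/
theorem exists_inverse_integral_inv {f : ℝ → ℝ} {b : ℝ} (hf : Continuous f) (hpos : ∀ u, 0 < f u)
    (hb : ∀ u, f u ≤ b) :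
    ∃ R : ℝ → ℝ, StrictMono R ∧ (∀ x, HasDerivAt R (f (R x)) x) ∧
      (∀ u, R (∫ y in (0 : ℝ)..u, (f y)⁻¹) = u) ∧ ∀ x, ∫ y in (0 : ℝ)..R x, (f y)⁻¹ = x := by
  set T : ℝ → ℝ := fun u => ∫ y in (0 : ℝ)..u, (f y)⁻¹ with hT
  have hcont : Continuous fun u => (f u)⁻¹ := hf.inv₀ fun u => (hpos u).ne'
  have hb0 : 0 < b := (hpos 0).trans_le (hb 0)
  have hderiv : ∀ u, HasDerivAt T (f u)⁻¹ u := fun u =>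
    intervalIntegral.integral_hasDerivAt_right (hcont.intervalIntegrable _ _)
      (hcont.stronglyMeasurableAtFilter _ _) hcont.continuousAt
  have hmono : StrictMono T := strictMono_of_deriv_pos fun u => by
    rw [(hderiv u).deriv]; exact inv_pos.2 (hpos u)
  have hTc : Continuous T := continuous_iff_continuousAt.2 fun u => (hderiv u).continuousAt
  -- `T' ≥ 1/b` forces at least linear growth in both directions, hence surjectivity of `T`.
  have hlow : Monotone fun u => T u - u / b := by
    have hd : ∀ u, HasDerivAt (fun u => T u - u / b) ((f u)⁻¹ - 1 / b) u :=
      fun u => (hderiv u).sub ((hasDerivAt_id u).div_const _)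
    refine monotone_of_deriv_nonneg (fun u => (hd u).differentiableAt) fun u => ?_
    rw [(hd u).deriv, sub_nonneg, one_div]
    exact inv_anti₀ (hpos u) (hb u)
  have hT0 : T 0 = 0 := by simp [hT]
  have hsurj : Function.Surjective T := by
    refine hTc.surjective ?_ ?_
    · refine tendsto_atTop_mono' _ ?_ (tendsto_id.atTop_div_const hb0)
      filter_upwards [eventually_ge_atTop 0] with u hu
      have := hlow hu
      simp only [hT0, zero_div] at this
      simp only [id]
      linarith
    · refine tendsto_atBot_mono' _ ?_ (tendsto_id.atBot_div_const hb0)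
      filter_upwards [eventually_le_atBot 0] with u hu
      have := hlow hu
      simp only [hT0, zero_div] at this
      simp only [id]
      linarith
  set e := hmono.orderIsoOfSurjective T hsurj with he
  have hes : ∀ x, T (e.symm x) = x := fun x => e.apply_symm_apply x
  refine ⟨e.symm, e.symm.strictMono, fun x => ?_, fun u => e.symm_apply_apply u, hes⟩
  have := HasDerivAt.of_local_left_inverse (f := T) (g := e.symm) (a := x)
    e.symm.continuous.continuousAt (hderiv _) (inv_pos.2 (hpos _)).ne' (Eventually.of_forall hes)
  simpa using this

/-- Separation of variables, run backwards in time from `y = 0`: `kertzIntegral c` is the time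
needed to pass between 0 and 1. The clamped denominator makes the solution global. -/
theorem exists_hasDerivAt_neg_kertzDen {c : ℝ} (hc : 0 < c) (h1 : kertzIntegral c = 1) :
    ∃ y : ℝ → ℝ, (∀ t, HasDerivAt y (-kertzDen c (y t)) t) ∧ y 0 = 1 ∧ y 1 = 0 ∧
      StrictAnti y := by
  obtain ⟨R, hR, hRd, hRl, -⟩ := exists_inverse_integral_inv (continuous_kertzDen c)
    (fun y => hc.trans_le (le_kertzDen c y)) (kertzDen_le c)
  refine ⟨fun t => R (1 - t), fun t => ?_, ?_, ?_, fun s t hst => hR (by linarith)⟩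
  · simpa [Function.comp_def] using (hRd (1 - t)).comp t ((hasDerivAt_id t).const_sub 1)
  · simp only [sub_zero]
    conv_lhs => rw [← h1]
    exact hRl 1
  · simpa using hRl 0

/-- Along the autonomous flow the speed `σ = kertzDen c (y t)` satisfies `(log σ)' = log y` and
`σ(0) = β⁻¹`; exponentiating the integrated identity gives the required equation. -/
theorem IsKertzConstant.exists_isSolution {β : ℝ} (h : IsKertzConstant β) :
    ∃ y : ℝ → ℝ, IsSolution β y := by
  have hc := h.sub_pos
  obtain ⟨y, hy, hy0, hy1, hanti⟩ :=
    exists_hasDerivAt_neg_kertzDen hc (isKertzConstant_iff.1 h).2.2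
  set c := β⁻¹ - 1 with hcdef
  have hmaps : MapsTo y (Icc 0 1) (Icc 0 1) := fun t ht =>
    ⟨hy1 ▸ hanti.antitone ht.2, hy0 ▸ hanti.antitone ht.1⟩
  have hyc : Continuous y := continuous_iff_continuousAt.2 fun t => (hy t).continuousAt
  have hpos : ∀ t, 0 < kertzDen c (y t) := fun t => hc.trans_le (le_kertzDen c _)
  set L : ℝ → ℝ := fun t => Real.log (kertzDen c (y t)) with hL
  have hLc : Continuous L :=
    ((continuous_kertzDen c).comp hyc).log fun t => (hpos t).ne'
  have hLd : ∀ t ∈ Ioo (0 : ℝ) 1, HasDerivAt L (Real.log (y t)) t := by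
    intro t ht
    have hy0' : 0 < y t := hy1 ▸ hanti ht.2
    have hd : HasDerivAt (fun s => c - y s * (Real.log (y s) - 1))
        (kertzDen c (y t) * Real.log (y t)) t := by
      refine (((hy t).mul (((hy t).log hy0'.ne').sub_const 1)).const_sub c).congr_deriv ?_
      rw [kertzDen_of_mem _ (hmaps ⟨ht.1.le, ht.2.le⟩)]
      field_simp
      ring
    have hev : (fun s => c - y s * (Real.log (y s) - 1)) =ᶠ[𝓝 t] fun s => kertzDen c (y s) := by
      filter_upwards [Ioo_mem_nhds ht.1 ht.2] with s hs
      rw [kertzDen_of_mem _ (hmaps ⟨hs.1.le, hs.2.le⟩)]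
    refine ((hev.hasDerivAt_iff.1 hd).log (hpos t).ne').congr_deriv ?_
    rw [mul_div_cancel_left₀ _ (hpos t).ne']
  -- `log y` is unbounded near `t = 1`, but it has constant sign and a primitive continuous up to
  -- the endpoints, which forces integrability.
  have hint : IntervalIntegrable (fun s => Real.log (y s)) volume 0 1 := by
    have := intervalIntegral.intervalIntegrable_deriv_of_nonneg (g := fun t => -L t)
      (g' := fun t => -Real.log (y t)) (a := 0) (b := 1) hLc.neg.continuousOn
      (fun t ht => by simp at ht; exact (hLd t ht).neg)
      (fun t ht => by
        simp at ht
        have := hmaps ⟨ht.1.le, ht.2.le⟩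
        exact neg_nonneg.2 (Real.log_nonpos this.1 this.2))
    simpa [Pi.neg_def] using this.neg
  have hD : ∀ t ∈ Icc (0 : ℝ) 1, D y t = -kertzDen c (y t) := fun t ht =>
    (hy t).hasDerivWithinAt.derivWithin (uniqueDiffOn_Icc zero_lt_one t ht)
  refine ⟨y, hmaps, fun t _ => (hy t).differentiableAt.differentiableWithinAt, hint,
    fun t ht => ?_, hy0, hy1⟩
  have hI : ∫ s in (0 : ℝ)..t, Real.log (y s) = L t - L 0 := by
    refine intervalIntegral.integral_eq_sub_of_hasDerivAt_of_le ht.1 hLc.continuousOn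
      (fun s hs => hLd s ⟨hs.1, hs.2.trans_le ht.2⟩) (hint.mono_set ?_)
    rw [uIcc_of_le ht.1, uIcc_of_le zero_le_one]
    exact Icc_subset_Icc_right ht.2
  have hk0 : kertzDen c (y 0) = β⁻¹ := by
    rw [hy0, kertzDen_of_mem _ (by simp)]; simp [hcdef]
  rw [hI, hD t ht, Real.exp_sub, hL]
  simp only
  rw [Real.exp_log (hpos t), Real.exp_log (hpos 0), hk0]
  have := h.1.ne'
  field_simp

/-! ### Properties of solutions of the differential equation -/

/-- `-y'`, extended constantly outside of `[0, 1]`. -/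
def speed (y : ℝ → ℝ) (t : ℝ) : ℝ := -D y (clamp t)

theorem clamp_mem (t : ℝ) : clamp t ∈ Icc (0 : ℝ) 1 := ⟨clamp_nonneg t, clamp_le_one t⟩

theorem speed_of_mem (y : ℝ → ℝ) {t : ℝ} (ht : t ∈ Icc (0 : ℝ) 1) : speed y t = -D y t := by
  rw [speed, clamp_of_mem ht]

namespace IsSolution

variable {β : ℝ} {y : ℝ → ℝ}

theorem speed_eq (h : IsSolution β y) (hβ : 0 < β) {t : ℝ} (ht : t ∈ Icc (0 : ℝ) 1) :
    speed y t = Real.exp (∫ s in (0 : ℝ)..t, Real.log (y s)) / β := by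
  rw [h.equation t ht, speed_of_mem y ht]
  field_simp

theorem speed_clamp (y : ℝ → ℝ) (t : ℝ) : speed y (clamp t) = speed y t := by
  rw [speed, clamp_of_mem (clamp_mem t), speed]

theorem speed_pos (h : IsSolution β y) (hβ : 0 < β) (t : ℝ) : 0 < speed y t := by
  rw [← speed_clamp, h.speed_eq hβ (clamp_mem t)]
  positivity

theorem speed_zero (h : IsSolution β y) (hβ : 0 < β) : speed y 0 = β⁻¹ := by
  rw [h.speed_eq hβ (by simp)]
  simp

/-- Only differentiability of `y` is assumed; continuity of `y'` comes from the equation, which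
writes it through a primitive of an integrable function. -/
theorem continuous_speed (h : IsSolution β y) (hβ : 0 < β) : Continuous (speed y) := by
  have h1 : ContinuousOn (speed y) (Icc 0 1) := by
    have h2 := intervalIntegral.continuousOn_primitive_interval' h.intervalIntegrable_log
      (left_mem_uIcc)
    rw [uIcc_of_le zero_le_one] at h2
    exact (h2.rexp.div_const β).congr fun t ht => h.speed_eq hβ ht
  have h2 : speed y = fun t => speed y (clamp t) := funext fun t => (speed_clamp y t).symm
  rw [h2]
  exact h1.comp_continuous continuous_clamp clamp_mem

theorem hasDerivWithinAt (h : IsSolution β y) {t : ℝ} (ht : t ∈ Icc (0 : ℝ) 1) :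
    HasDerivWithinAt y (-speed y t) (Icc 0 1) t := by
  rw [speed_of_mem y ht, neg_neg]
  exact (h.differentiableOn t ht).hasDerivWithinAt

theorem hasDerivAt (h : IsSolution β y) {t : ℝ} (ht : t ∈ Ioo (0 : ℝ) 1) :
    HasDerivAt y (-speed y t) t :=
  (h.hasDerivWithinAt ⟨ht.1.le, ht.2.le⟩).hasDerivAt (Icc_mem_nhds ht.1 ht.2)

theorem continuousOn (h : IsSolution β y) : ContinuousOn y (Icc 0 1) :=
  h.differentiableOn.continuousOn

theorem strictAntiOn (h : IsSolution β y) (hβ : 0 < β) : StrictAntiOn y (Icc 0 1) := by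
  refine strictAntiOn_of_deriv_neg (convex_Icc 0 1) h.continuousOn fun t ht => ?_
  rw [interior_Icc] at ht
  rw [(h.hasDerivAt ht).deriv]
  linarith [h.speed_pos hβ t]

theorem pos (h : IsSolution β y) (hβ : 0 < β) {t : ℝ} (ht : t ∈ Ico (0 : ℝ) 1) : 0 < y t := by
  rw [← h.one]
  exact h.strictAntiOn hβ ⟨ht.1, ht.2.le⟩ (by simp) ht.2

theorem lt_one (h : IsSolution β y) (hβ : 0 < β) {t : ℝ} (ht : t ∈ Ioc (0 : ℝ) 1) : y t < 1 := by
  rw [← h.zero]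
  exact h.strictAntiOn hβ (by simp) ⟨ht.1.le, ht.2⟩ ht.1

theorem log_neg (h : IsSolution β y) (hβ : 0 < β) {t : ℝ} (ht : t ∈ Ioo (0 : ℝ) 1) :
    Real.log (y t) < 0 :=
  Real.log_neg (h.pos hβ ⟨ht.1.le, ht.2⟩) (h.lt_one hβ ⟨ht.1, ht.2.le⟩)

/-- The differentiated equation, `y'' = y' log y`. The endpoint 1 is excluded because `y` vanishes
there. -/
theorem hasDerivAt_speed (h : IsSolution β y) (hβ : 0 < β) {t : ℝ} (ht : t ∈ Ioo (0 : ℝ) 1) :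
    HasDerivAt (speed y) (speed y t * Real.log (y t)) t := by
  have hcl : ContinuousOn (fun s => Real.log (y s)) (Ioo 0 1) :=
    (h.continuousOn.mono Ioo_subset_Icc_self).log fun s hs => (h.pos hβ ⟨hs.1.le, hs.2⟩).ne'
  have hd : HasDerivAt (fun t => ∫ s in (0 : ℝ)..t, Real.log (y s)) (Real.log (y t)) t := by
    refine intervalIntegral.integral_hasDerivAt_right (h.intervalIntegrable_log.mono_set ?_)
      (hcl.stronglyMeasurableAtFilter isOpen_Ioo _ ht) (hcl.continuousAt (Ioo_mem_nhds ht.1 ht.2))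
    rw [uIcc_of_le ht.1.le, uIcc_of_le zero_le_one]
    exact Icc_subset_Icc_right ht.2.le
  have hev : speed y =ᶠ[𝓝 t] fun t => Real.exp (∫ s in (0 : ℝ)..t, Real.log (y s)) / β := by
    filter_upwards [Ioo_mem_nhds ht.1 ht.2] with s hs
    exact h.speed_eq hβ ⟨hs.1.le, hs.2.le⟩
  refine ((hd.exp.div_const β).congr_of_eventuallyEq hev).congr_deriv ?_
  rw [h.speed_eq hβ ⟨ht.1.le, ht.2.le⟩]
  ring

/-- The first integral of the differential equation. -/
theorem speed_eq_kertz (h : IsSolution β y) (hβ : 0 < β) {t : ℝ} (ht : t ∈ Icc (0 : ℝ) 1) :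
    speed y t = (β⁻¹ - 1) - y t * (Real.log (y t) - 1) := by
  have hc : ContinuousOn (fun t => speed y t + y t * (Real.log (y t) - 1)) (Icc 0 1) :=
    (h.continuous_speed hβ).continuousOn.add
      (continuous_mul_log_sub_one.comp_continuousOn h.continuousOn)
  have hd : ∀ s ∈ Ioo (0 : ℝ) 1,
      HasDerivAt (fun t => speed y t + y t * (Real.log (y t) - 1)) 0 s := by
    intro s hs
    have hy := h.pos hβ ⟨hs.1.le, hs.2⟩
    have hys := h.hasDerivAt hs
    refine ((h.hasDerivAt_speed hβ hs).add (hys.mul ((hys.log hy.ne').sub_const 1))).congr_deriv ?_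
    field_simp
    ring
  have key := intervalIntegral.integral_eq_sub_of_hasDerivAt_of_le ht.1
    (hc.mono (Icc_subset_Icc_right ht.2)) (fun s hs => hd s ⟨hs.1, hs.2.trans_le ht.2⟩)
    (by simp)
  simp only [intervalIntegral.integral_zero, h.zero, h.speed_zero hβ, Real.log_one] at key
  linarith

theorem speed_le (h : IsSolution β y) (hβ : 0 < β) (t : ℝ) : speed y t ≤ β⁻¹ := by
  rw [← speed_clamp, h.speed_eq_kertz hβ (clamp_mem t)]
  have := neg_one_le_mul_log_sub_one (h.mapsTo (clamp_mem t)).1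
  linarith

end IsSolution

/-! ### The threshold function, its inverse, and a uniform formula for `F` -/

/-- The optimal threshold `∫_t^1 ds / |y'(s)|` (with `t` not restricted to `[0, 1]`). -/
def threshold (y : ℝ → ℝ) (t : ℝ) : ℝ := ∫ s in t..1, (speed y s)⁻¹

theorem threshold_one (y : ℝ → ℝ) : threshold y 1 = 0 := by simp [threshold]

theorem neg_integral_D_eq_threshold (y : ℝ → ℝ) {t : ℝ} (ht : t ∈ Icc (0 : ℝ) 1) :
    -∫ s in t..1, 1 / D y s = threshold y t := by
  rw [threshold, ← intervalIntegral.integral_neg]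
  refine intervalIntegral.integral_congr fun s hs => ?_
  rw [uIcc_of_le ht.2] at hs
  simp only [speed_of_mem y ⟨ht.1.trans hs.1, hs.2⟩, one_div, inv_neg]

theorem rStar_eq_threshold (y : ℝ → ℝ) {q t : ℝ} (hq : 0 ≤ q) (ht : t ∈ Icc q 1) :
    rStar y q t = threshold y t := by
  rw [rStar, if_pos ht.1, neg_integral_D_eq_threshold y ⟨hq.trans ht.1, ht.2⟩]

theorem H_eq (y : ℝ → ℝ) {q : ℝ} (hq : q ∈ Icc (0 : ℝ) 1) :
    H y q = threshold y q + 1 / (speed y q * -Real.log (y q)) := by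
  rw [H, ← neg_integral_D_eq_threshold y hq, speed_of_mem y hq, neg_mul_neg]
  ring

/-- The inverse function of `threshold y`. -/
def thresholdInv (y : ℝ → ℝ) : ℝ → ℝ := Function.invFun (threshold y)

namespace IsSolution

variable {β : ℝ} {y : ℝ → ℝ}

theorem continuous_inv_speed (h : IsSolution β y) (hβ : 0 < β) :
    Continuous fun t => (speed y t)⁻¹ :=
  (h.continuous_speed hβ).inv₀ fun t => (h.speed_pos hβ t).ne'

theorem hasDerivAt_threshold (h : IsSolution β y) (hβ : 0 < β) (t : ℝ) :
    HasDerivAt (threshold y) (-(speed y t)⁻¹) t :=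
  intervalIntegral.integral_hasDerivAt_left ((h.continuous_inv_speed hβ).intervalIntegrable _ _)
    ((h.continuous_inv_speed hβ).stronglyMeasurableAtFilter _ _)
    (h.continuous_inv_speed hβ).continuousAt

theorem continuous_threshold (h : IsSolution β y) (hβ : 0 < β) : Continuous (threshold y) :=
  continuous_iff_continuousAt.2 fun t => (h.hasDerivAt_threshold hβ t).continuousAt

theorem strictAnti_threshold (h : IsSolution β y) (hβ : 0 < β) : StrictAnti (threshold y) :=
  strictAnti_of_deriv_neg fun t => by
    rw [(h.hasDerivAt_threshold hβ t).deriv]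
    have := inv_pos.2 (h.speed_pos hβ t)
    linarith

theorem threshold_pos (h : IsSolution β y) (hβ : 0 < β) {t : ℝ} (ht : t < 1) :
    0 < threshold y t := by
  rw [← threshold_one y]
  exact h.strictAnti_threshold hβ ht

theorem thresholdInv_threshold (h : IsSolution β y) (hβ : 0 < β) (t : ℝ) :
    thresholdInv y (threshold y t) = t :=
  Function.leftInverse_invFun (h.strictAnti_threshold hβ).injective t

/-- `threshold y` is a constant minus `∫_0^t 1/speed`, so its inverse is the reflected solution of
`R' = speed R`. -/
theorem thresholdInv_spec (h : IsSolution β y) (hβ : 0 < β) :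
    (∀ x, threshold y (thresholdInv y x) = x) ∧ StrictAnti (thresholdInv y) ∧
      ∀ x, HasDerivAt (thresholdInv y) (-speed y (thresholdInv y x)) x := by
  obtain ⟨R, hR, hRd, hRl, hRr⟩ := exists_inverse_integral_inv (h.continuous_speed hβ)
    (h.speed_pos hβ) (h.speed_le hβ)
  have hthr : ∀ t, threshold y t = threshold y 0 - ∫ s in (0 : ℝ)..t, (speed y s)⁻¹ := fun t => by
    have hi := fun a b => (h.continuous_inv_speed hβ).intervalIntegrable (μ := volume) a b
    rw [threshold, threshold, ← intervalIntegral.integral_add_adjacent_intervals (hi 0 t) (hi t 1)]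
    ring
  have hr : ∀ x, threshold y (R (threshold y 0 - x)) = x := fun x => by
    rw [hthr, hRr]; ring
  have heq : thresholdInv y = fun x => R (threshold y 0 - x) := funext fun x => by
    conv_lhs => rw [← hr x]
    exact h.thresholdInv_threshold hβ _
  rw [heq]
  refine ⟨hr, fun a b hab => hR (by linarith), fun x => ?_⟩
  simpa [Function.comp_def] using (hRd _).comp x ((hasDerivAt_id x).const_sub (threshold y 0))

theorem threshold_thresholdInv (h : IsSolution β y) (hβ : 0 < β) (x : ℝ) :
    threshold y (thresholdInv y x) = x := (h.thresholdInv_spec hβ).1 x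

theorem strictAnti_thresholdInv (h : IsSolution β y) (hβ : 0 < β) :
    StrictAnti (thresholdInv y) := (h.thresholdInv_spec hβ).2.1

theorem hasDerivAt_thresholdInv (h : IsSolution β y) (hβ : 0 < β) (x : ℝ) :
    HasDerivAt (thresholdInv y) (-speed y (thresholdInv y x)) x := (h.thresholdInv_spec hβ).2.2 x

theorem continuous_thresholdInv (h : IsSolution β y) (hβ : 0 < β) :
    Continuous (thresholdInv y) :=
  continuous_iff_continuousAt.2 fun x => (h.hasDerivAt_thresholdInv hβ x).continuousAt

theorem le_thresholdInv_iff (h : IsSolution β y) (hβ : 0 < β) {t x : ℝ} :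
    t ≤ thresholdInv y x ↔ x ≤ threshold y t := by
  conv_lhs => rw [← (h.strictAnti_threshold hβ).le_iff_ge]
  rw [h.threshold_thresholdInv hβ]

theorem thresholdInv_le_iff (h : IsSolution β y) (hβ : 0 < β) {t x : ℝ} :
    thresholdInv y x ≤ t ↔ threshold y t ≤ x := by
  conv_lhs => rw [← (h.strictAnti_threshold hβ).le_iff_ge]
  rw [h.threshold_thresholdInv hβ]

theorem threshold_lt_H (h : IsSolution β y) (hβ : 0 < β) {q : ℝ} (hq : q ∈ Ioo (0 : ℝ) 1) :
    threshold y q < H y q := by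
  rw [H_eq y ⟨hq.1.le, hq.2.le⟩]
  have h1 := h.speed_pos hβ q
  have h2 := neg_pos.2 (h.log_neg hβ hq)
  have : 0 < 1 / (speed y q * -Real.log (y q)) := by positivity
  linarith

/-- The distribution function `F y q` to the left of its jump at `H y q`. -/
theorem F_eq (h : IsSolution β y) (hβ : 0 < β) {q : ℝ} (hq : q ∈ Ioo (0 : ℝ) 1) (x : ℝ) :
    F y q x = if x < H y q then y (clamp (max q (thresholdInv y x))) else 1 := by
  have hH := h.threshold_lt_H hβ hq
  have h0 := h.threshold_pos hβ hq.2
  unfold F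
  rw [rStar_eq_threshold y hq.1.le ⟨le_rfl, hq.2.le⟩]
  rcases lt_or_ge x 0 with hx | hx
  -- For negative `x` the inverse exceeds 1, and the clamp sends it to 1, where `y` vanishes.
  · have h1 : 1 < thresholdInv y x := by
      rw [← not_le, h.thresholdInv_le_iff hβ, threshold_one]; linarith
    rw [if_pos hx, if_pos (by linarith), max_eq_right (by linarith [hq.2]), clamp,
      min_eq_right h1.le, max_eq_right zero_le_one, h.one]
  · rw [if_neg hx.not_gt]
    split_ifs with h1 h2 h2
    · have hq1 : q ≤ thresholdInv y x := (h.le_thresholdInv_iff hβ).2 h1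
      have h11 : thresholdInv y x ≤ 1 := by
        rw [h.thresholdInv_le_iff hβ, threshold_one]; exact hx
      have hmem : thresholdInv y x ∈ Icc q 1 := ⟨hq1, h11⟩
      rw [max_eq_right hq1, clamp_of_mem ⟨hq.1.le.trans hq1, h11⟩]
      congr 1
      have hinj : InjOn (rStar y q) (Icc q 1) := fun a ha b hb hab => by
        rw [rStar_eq_threshold y hq.1.le ha, rStar_eq_threshold y hq.1.le hb] at hab
        exact (h.strictAnti_threshold hβ).injective hab
      have hex : ∃ a ∈ Icc q 1, rStar y q a = x :=
        ⟨_, hmem, by rw [rStar_eq_threshold y hq.1.le hmem, h.threshold_thresholdInv hβ]⟩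
      refine hinj (Function.invFunOn_mem hex) hmem ?_
      rw [Function.invFunOn_eq hex, rStar_eq_threshold y hq.1.le hmem,
        h.threshold_thresholdInv hβ]
    · linarith
    · rw [max_eq_left, clamp_of_mem ⟨hq.1.le, hq.2.le⟩]
      rw [h.thresholdInv_le_iff hβ]
      linarith
    · rfl

end IsSolution

/-! ### The distribution with c.d.f. `F y q ^ (1 / n)` -/

namespace IsSolution

variable {β : ℝ} {y : ℝ → ℝ} {q : ℝ}

theorem F_of_lt_H (h : IsSolution β y) (hβ : 0 < β) (hq : q ∈ Ioo (0 : ℝ) 1) {x : ℝ}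
    (hx : x < H y q) : F y q x = y (clamp (max q (thresholdInv y x))) := by
  rw [h.F_eq hβ hq, if_pos hx]

theorem F_of_H_le (h : IsSolution β y) (hβ : 0 < β) (hq : q ∈ Ioo (0 : ℝ) 1) {x : ℝ}
    (hx : H y q ≤ x) : F y q x = 1 := by
  rw [h.F_eq hβ hq, if_neg hx.not_gt]

theorem H_pos (h : IsSolution β y) (hβ : 0 < β) (hq : q ∈ Ioo (0 : ℝ) 1) : 0 < H y q :=
  (h.threshold_pos hβ hq.2).trans (h.threshold_lt_H hβ hq)

theorem F_threshold (h : IsSolution β y) (hβ : 0 < β) (hq : q ∈ Ioo (0 : ℝ) 1) {t : ℝ}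
    (ht : t ∈ Icc q 1) : F y q (threshold y t) = y t := by
  rw [h.F_of_lt_H hβ hq (((h.strictAnti_threshold hβ).antitone ht.1).trans_lt
    (h.threshold_lt_H hβ hq)), h.thresholdInv_threshold hβ, max_eq_right ht.1,
    clamp_of_mem ⟨hq.1.le.trans ht.1, ht.2⟩]

theorem F_of_threshold_le (h : IsSolution β y) (hβ : 0 < β) (hq : q ∈ Ioo (0 : ℝ) 1) {x : ℝ}
    (hx : threshold y q ≤ x) (hxH : x < H y q) : F y q x = y q := by
  rw [h.F_of_lt_H hβ hq hxH, max_eq_left ((h.thresholdInv_le_iff hβ).2 hx),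
    clamp_of_mem ⟨hq.1.le, hq.2.le⟩]

theorem F_of_neg (x : ℝ) (hx : x < 0) : F y q x = 0 := by rw [F, if_pos hx]

theorem F_mem_Icc (h : IsSolution β y) (hβ : 0 < β) (hq : q ∈ Ioo (0 : ℝ) 1) (x : ℝ) :
    F y q x ∈ Icc (0 : ℝ) 1 := by
  rw [h.F_eq hβ hq]
  split_ifs
  · exact h.mapsTo (clamp_mem _)
  · simp

theorem F_pos (h : IsSolution β y) (hβ : 0 < β) (hq : q ∈ Ioo (0 : ℝ) 1) {x : ℝ} (hx : 0 < x) :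
    0 < F y q x := by
  rw [h.F_eq hβ hq]
  split_ifs
  · refine h.pos hβ ⟨clamp_nonneg _, max_lt zero_lt_one ((min_le_left _ _).trans_lt ?_)⟩
    refine max_lt hq.2 ?_
    rw [← not_le, h.le_thresholdInv_iff hβ, threshold_one]
    exact hx.not_ge
  · exact one_pos

theorem monotone_F (h : IsSolution β y) (hβ : 0 < β) (hq : q ∈ Ioo (0 : ℝ) 1) :
    Monotone (F y q) := by
  intro a b hab
  rcases lt_or_ge b (H y q) with hb | hb
  · rw [h.F_of_lt_H hβ hq hb, h.F_of_lt_H hβ hq (hab.trans_lt hb)]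
    refine (h.strictAntiOn hβ).antitoneOn (clamp_mem _) (clamp_mem _) ?_
    exact max_le_max_left _ (min_le_min_right _
      (max_le_max_left _ ((h.strictAnti_thresholdInv hβ).antitone hab)))
  · rw [h.F_of_H_le hβ hq hb]
    exact (h.F_mem_Icc hβ hq a).2

theorem continuousWithinAt_F (h : IsSolution β y) (hβ : 0 < β) (hq : q ∈ Ioo (0 : ℝ) 1) (x : ℝ) :
    ContinuousWithinAt (F y q) (Ici x) x := by
  rcases lt_or_ge x (H y q) with hx | hx
  · have hc : Continuous fun x => y (clamp (max q (thresholdInv y x))) :=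
      h.continuousOn.comp_continuous
        (continuous_clamp.comp (continuous_const.max (h.continuous_thresholdInv hβ)))
        fun x => clamp_mem _
    refine (hc.continuousAt.congr ?_).continuousWithinAt
    filter_upwards [Iio_mem_nhds hx] with z hz
    exact (h.F_of_lt_H hβ hq hz).symm
  · refine (continuousWithinAt_const (b := (1 : ℝ))).congr (fun z hz => ?_)
      (h.F_of_H_le hβ hq hx)
    exact h.F_of_H_le hβ hq (hx.trans hz)

end IsSolution

/-- The Stieltjes function is built from right limits; right continuity makes it coincide with `G`.
-/
theorem lawOfCdf_eq {G : ℝ → ℝ} (hG : Monotone G) (hr : ∀ x, ContinuousWithinAt G (Ici x) x)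
    (h0 : Tendsto G atBot (𝓝 0)) (h1 : Tendsto G atTop (𝓝 1)) :
    IsProbabilityMeasure (lawOfCdf G) ∧ ∀ x, lawOfCdf G (Iic x) = ENNReal.ofReal (G x) := by
  have heq : ⇑hG.stieltjesFunction = G := by
    funext x
    rw [hG.stieltjesFunction_eq]
    exact ContinuousWithinAt.rightLim_eq (hr x)
  rw [lawOfCdf, dif_pos hG]
  refine ⟨StieltjesFunction.isProbabilityMeasure _ (by rwa [heq]) (by rwa [heq]), fun x => ?_⟩
  rw [StieltjesFunction.measure_Iic _ (by rwa [heq]), heq, sub_zero]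

namespace IsSolution

variable {β : ℝ} {y : ℝ → ℝ} {q : ℝ}

theorem law_spec (h : IsSolution β y) (hβ : 0 < β) (hq : q ∈ Ioo (0 : ℝ) 1) {n : ℕ}
    (hn : 1 ≤ n) :
    IsProbabilityMeasure (law y q n) ∧
      ∀ x, law y q n (Iic x) = ENNReal.ofReal (F y q x ^ (1 / (n : ℝ))) := by
  have hn' : (0 : ℝ) < 1 / (n : ℝ) := by positivity
  refine lawOfCdf_eq (fun a b hab => ?_) (fun x => ?_) ?_ ?_
  · exact Real.rpow_le_rpow (h.F_mem_Icc hβ hq a).1 (h.monotone_F hβ hq hab) hn'.le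
  · exact (h.continuousWithinAt_F hβ hq x).rpow_const (Or.inr hn'.le)
  · refine tendsto_const_nhds.congr' ?_
    filter_upwards [Iio_mem_atBot 0] with x hx
    rw [F_of_neg x hx, Real.zero_rpow hn'.ne']
  · refine tendsto_const_nhds.congr' ?_
    filter_upwards [Ici_mem_atTop (H y q)] with x hx
    rw [h.F_of_H_le hβ hq hx, Real.one_rpow]

theorem law_real_Iic (h : IsSolution β y) (hβ : 0 < β) (hq : q ∈ Ioo (0 : ℝ) 1) {n : ℕ}
    (hn : 1 ≤ n) (x : ℝ) : (law y q n).real (Iic x) = F y q x ^ (1 / (n : ℝ)) := by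
  rw [Measure.real, (h.law_spec hβ hq hn).2, ENNReal.toReal_ofReal]
  exact Real.rpow_nonneg (h.F_mem_Icc hβ hq x).1 _

end IsSolution

/-! ### Integrals of the distribution function -/

/-- Nonnegativity of `f` gives integrability for free, so a logarithmic singularity of `f` at an
endpoint is harmless as long as `A` is continuous there. -/
theorem intervalIntegral_of_antiderivative_neg {A f : ℝ → ℝ} {a b : ℝ} (hab : a ≤ b)
    (hA : ContinuousOn A (Icc a b)) (hd : ∀ x ∈ Ioo a b, HasDerivAt A (-f x) x)
    (hf : ∀ x ∈ Ioo a b, 0 ≤ f x) :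
    IntervalIntegrable f volume a b ∧ ∫ x in a..b, f x = A a - A b := by
  have hd' : ∀ x ∈ Ioo a b, HasDerivAt (fun x => -A x) (f x) x := fun x hx => by
    exact (hd x hx).neg.congr_deriv (neg_neg _)
  have hi : IntervalIntegrable f volume a b := by
    refine intervalIntegral.intervalIntegrable_deriv_of_nonneg (g := fun x => -A x) ?_ ?_ ?_
    · rw [uIcc_of_le hab]; exact hA.neg
    · simpa [hab] using hd'
    · simpa [hab] using hf
  refine ⟨hi, ?_⟩
  rw [intervalIntegral.integral_eq_sub_of_hasDerivAt_of_le hab hA.neg hd' hi,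
    Pi.neg_apply, Pi.neg_apply]
  ring

namespace IsSolution

variable {β : ℝ} {y : ℝ → ℝ} {q : ℝ}

theorem thresholdInv_mem_Ioo (h : IsSolution β y) (hβ : 0 < β) {a x : ℝ}
    (hx : x ∈ Ioo 0 (threshold y a)) : thresholdInv y x ∈ Ioo a 1 := by
  constructor
  · rw [← not_le, h.thresholdInv_le_iff hβ]
    exact hx.2.not_ge
  · rw [← not_le, h.le_thresholdInv_iff hβ, threshold_one]
    exact hx.1.not_ge

theorem threshold_nonneg (h : IsSolution β y) (hβ : 0 < β) {t : ℝ} (ht : t ≤ 1) :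
    0 ≤ threshold y t := by
  rw [← threshold_one y]
  exact (h.strictAnti_threshold hβ).antitone ht

theorem F_of_mem (h : IsSolution β y) (hβ : 0 < β) (hq : q ∈ Ioo (0 : ℝ) 1) {x : ℝ}
    (hx : x ∈ Ioo 0 (threshold y q)) : F y q x = y (thresholdInv y x) := by
  have hm := h.thresholdInv_mem_Ioo hβ hx
  conv_lhs => rw [← h.threshold_thresholdInv hβ x]
  exact h.F_threshold hβ hq ⟨hm.1.le, hm.2.le⟩

theorem neg_log_F_nonneg (h : IsSolution β y) (hβ : 0 < β) (hq : q ∈ Ioo (0 : ℝ) 1) (x : ℝ) :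
    0 ≤ -Real.log (F y q x) :=
  neg_nonneg.2 (Real.log_nonpos (h.F_mem_Icc hβ hq x).1 (h.F_mem_Icc hβ hq x).2)

/-- With `R = thresholdInv y`, the relations `speed' = speed · log y` and `R' = -speed R` make `1 /
speed (R x)` a primitive of `log F`. -/
theorem integral_neg_log_F_threshold (h : IsSolution β y) (hβ : 0 < β) (hq : q ∈ Ioo (0 : ℝ) 1)
    {t : ℝ} (ht : t ∈ Icc q 1) :
    IntervalIntegrable (fun x => -Real.log (F y q x)) volume (threshold y t) (threshold y q) ∧
      ∫ x in threshold y t..threshold y q, -Real.log (F y q x) =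
        (speed y t)⁻¹ - (speed y q)⁻¹ := by
  have key := intervalIntegral_of_antiderivative_neg (A := fun x => (speed y (thresholdInv y x))⁻¹)
    (f := fun x => -Real.log (F y q x)) ((h.strictAnti_threshold hβ).antitone ht.1)
    ((h.continuous_inv_speed hβ).comp (h.continuous_thresholdInv hβ)).continuousOn ?_
    fun x _ => h.neg_log_F_nonneg hβ hq x
  · simpa only [h.thresholdInv_threshold hβ] using key
  · intro x hx
    have hx' : x ∈ Ioo 0 (threshold y q) := ⟨(h.threshold_nonneg hβ ht.2).trans_lt hx.1, hx.2⟩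
    have hm := h.thresholdInv_mem_Ioo hβ hx'
    have hs := (h.speed_pos hβ (thresholdInv y x)).ne'
    have := ((h.hasDerivAt_speed hβ ⟨hq.1.trans hm.1, hm.2⟩).comp x
      (h.hasDerivAt_thresholdInv hβ x)).inv hs
    refine this.congr_deriv ?_
    rw [h.F_of_mem hβ hq hx', Function.comp_apply]
    field_simp

theorem integral_neg_log_F_const (h : IsSolution β y) (hβ : 0 < β) (hq : q ∈ Ioo (0 : ℝ) 1)
    {x : ℝ} (hx : x ∈ Icc (threshold y q) (H y q)) :
    IntervalIntegrable (fun x => -Real.log (F y q x)) volume x (H y q) ∧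
      ∫ u in x..H y q, -Real.log (F y q u) = (H y q - x) * -Real.log (y q) := by
  have key := intervalIntegral_of_antiderivative_neg (A := fun x => x * Real.log (y q))
    (f := fun x => -Real.log (F y q x)) hx.2 (by fun_prop) ?_
    fun x _ => h.neg_log_F_nonneg hβ hq x
  · refine ⟨key.1, key.2.trans (by ring)⟩
  · intro u hu
    rw [h.F_of_threshold_le hβ hq (hx.1.trans hu.1.le) hu.2]
    simpa using (hasDerivAt_id u).mul_const (Real.log (y q))

/-- This is what the choice of `H` achieves: the flat piece of `F` supplies exactly the boundary
term missing at `t = q`. -/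
theorem H_sub_threshold_mul (h : IsSolution β y) (hβ : 0 < β) (hq : q ∈ Ioo (0 : ℝ) 1) :
    (H y q - threshold y q) * -Real.log (y q) = (speed y q)⁻¹ := by
  rw [H_eq y ⟨hq.1.le, hq.2.le⟩]
  have := (h.speed_pos hβ q).ne'
  have := (h.log_neg hβ hq).ne
  field_simp
  ring

theorem intervalIntegrable_neg_log_F (h : IsSolution β y) (hβ : 0 < β) (hq : q ∈ Ioo (0 : ℝ) 1) :
    IntervalIntegrable (fun x => -Real.log (F y q x)) volume 0 (H y q) := by
  have h1 := (h.integral_neg_log_F_threshold hβ hq (t := 1) ⟨hq.2.le, le_rfl⟩).1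
  rw [threshold_one] at h1
  exact h1.trans (h.integral_neg_log_F_const hβ hq
    ⟨le_rfl, (h.threshold_lt_H hβ hq).le⟩).1

/-- The right side equals `-r'(t)` for `r = threshold y`, so reversed in time `r` solves the
limiting equation of the dynamic program. -/
theorem integral_neg_log_F (h : IsSolution β y) (hβ : 0 < β) (hq : q ∈ Ioo (0 : ℝ) 1)
    {t : ℝ} (ht : t ∈ Icc q 1) :
    ∫ x in threshold y t..H y q, -Real.log (F y q x) = (speed y t)⁻¹ := by
  have h1 := h.integral_neg_log_F_threshold hβ hq ht
  have h2 := h.integral_neg_log_F_const hβ hq ⟨le_rfl, (h.threshold_lt_H hβ hq).le⟩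
  rw [← intervalIntegral.integral_add_adjacent_intervals h1.1 h2.1, h1.2, h2.2,
    h.H_sub_threshold_mul hβ hq]
  ring

theorem intervalIntegrable_one_sub_F (h : IsSolution β y) (hβ : 0 < β) (hq : q ∈ Ioo (0 : ℝ) 1)
    (a b : ℝ) : IntervalIntegrable (fun x => 1 - F y q x) volume a b :=
  intervalIntegrable_const.sub (h.monotone_F hβ hq).intervalIntegrable

theorem integral_one_sub_F (h : IsSolution β y) (hβ : 0 < β) (hq : q ∈ Ioo (0 : ℝ) 1) :
    ∫ x in (0 : ℝ)..H y q, (1 - F y q x) =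
      threshold y q / β - y q / speed y q + (1 - y q) * (H y q - threshold y q) := by
  have hi := h.intervalIntegrable_one_sub_F hβ hq
  have h0 : (0 : ℝ) ≤ threshold y q := h.threshold_nonneg hβ hq.2.le
  have hinv1 : thresholdInv y 0 = 1 := by
    have := h.thresholdInv_threshold hβ 1
    rwa [threshold_one] at this
  have h1 : ∫ x in (0 : ℝ)..threshold y q, (1 - F y q x) =
      threshold y q / β - y q / speed y q := by
    have hmaps : MapsTo (thresholdInv y) (Icc 0 (threshold y q)) (Icc 0 1) := fun x hx =>
      ⟨hq.1.le.trans ((h.le_thresholdInv_iff hβ).2 hx.2), by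
        rw [h.thresholdInv_le_iff hβ, threshold_one]; exact hx.1⟩
    have hR := (h.continuous_thresholdInv hβ).continuousOn (s := Icc 0 (threshold y q))
    -- The derivative of this primitive is `speed + y log y - 1/β`, which the first integral reduces
    -- to `y - 1`.
    have key := (intervalIntegral_of_antiderivative_neg
      (A := fun x => y (thresholdInv y x) / speed y (thresholdInv y x) - x / β)
      (f := fun x => 1 - F y q x) h0 ?_ ?_ fun x _ => sub_nonneg.2 (h.F_mem_Icc hβ hq x).2).2
    · rw [key, hinv1, h.one, h.thresholdInv_threshold hβ]
      ring
    · refine ((h.continuousOn.comp hR hmaps).div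
        ((h.continuous_speed hβ).comp_continuousOn hR) fun x _ => (h.speed_pos hβ _).ne').sub
        (by fun_prop)
    · intro x hx
      have hm := h.thresholdInv_mem_Ioo hβ hx
      have hm' : thresholdInv y x ∈ Ioo (0 : ℝ) 1 := ⟨hq.1.trans hm.1, hm.2⟩
      have hs := (h.speed_pos hβ (thresholdInv y x)).ne'
      have hR := h.hasDerivAt_thresholdInv hβ x
      have := ((((h.hasDerivAt hm').div (h.hasDerivAt_speed hβ hm') hs).comp x hR)).sub
        ((hasDerivAt_id x).div_const β)
      refine this.congr_deriv ?_
      have hk := h.speed_eq_kertz hβ ⟨hm'.1.le, hm'.2.le⟩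
      rw [h.F_of_mem hβ hq hx]
      set w := speed y (thresholdInv y x)
      set u := y (thresholdInv y x)
      have : 1 / β = w + 1 + u * (Real.log u - 1) := by rw [hk, one_div]; ring
      rw [this]
      field_simp
      ring
  have h2 : ∫ x in threshold y q..H y q, (1 - F y q x) =
      (1 - y q) * (H y q - threshold y q) := by
    have key := (intervalIntegral_of_antiderivative_neg (A := fun x => -((1 - y q) * x))
      (f := fun x => 1 - F y q x) (h.threshold_lt_H hβ hq).le (by fun_prop) ?_
      fun x _ => sub_nonneg.2 (h.F_mem_Icc hβ hq x).2).2
    · rw [key]; ring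
    · intro x hx
      rw [h.F_of_threshold_le hβ hq hx.1.le hx.2]
      exact ((hasDerivAt_id x).const_mul (1 - y q)).neg.congr_deriv (by ring)
  rw [← intervalIntegral.integral_add_adjacent_intervals (hi 0 _) (hi _ _), h1, h2]

end IsSolution

/-! ### The expected maximum -/

/-- Layer cake formula for `E[max(X, a)]`, where `X ≤ b` has c.d.f. `G`. -/
theorem lintegral_ofReal_max {μ : Measure ℝ} [IsProbabilityMeasure μ] {G : ℝ → ℝ} {a b : ℝ}
    (hG : ∀ x, μ (Iic x) = ENNReal.ofReal (G x)) (hmono : Monotone G) (h0 : ∀ x, 0 ≤ G x)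
    (h1 : ∀ x, b ≤ x → G x = 1) (ha : 0 ≤ a) (hab : a ≤ b) :
    ∫⁻ x, ENNReal.ofReal (max x a) ∂μ = ENNReal.ofReal (a + ∫ x in a..b, (1 - G x)) := by
  have hle : ∀ x, G x ≤ 1 := fun x =>
    (hmono (le_max_left x b)).trans_eq (h1 _ (le_max_right x b))
  have hIoi : ∀ x, μ (Ioi x) = ENNReal.ofReal (1 - G x) := fun x => by
    rw [← compl_Iic, prob_compl_eq_one_sub measurableSet_Iic, hG, ENNReal.ofReal_sub _ (h0 x),
      ENNReal.ofReal_one]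
  have hmono' : Monotone fun t => G (t + a) := fun s t hst => hmono (by linarith)
  have hsplit : ∀ x, ENNReal.ofReal (max x a) =
      ENNReal.ofReal a + ENNReal.ofReal (max (x - a) 0) := fun x => by
    rw [← ENNReal.ofReal_add ha (le_max_right _ _)]
    congr 1
    rw [← max_add_add_left]
    simp
  have htail : ∫⁻ x, ENNReal.ofReal (max (x - a) 0) ∂μ =
      ∫⁻ t in Ioi 0, ENNReal.ofReal (1 - G (t + a)) := by
    rw [lintegral_eq_lintegral_meas_lt μ (f := fun x => max (x - a) 0)
      (Eventually.of_forall fun x => le_max_right (x - a) 0) (by fun_prop)]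
    refine setLIntegral_congr_fun measurableSet_Ioi fun t ht => ?_
    rw [← hIoi]
    congr 1
    ext x
    have ht' : 0 < t := ht
    simp only [mem_ofPred_eq, lt_max_iff, ht'.not_gt, or_false, mem_Ioi]
    exact lt_sub_iff_add_lt
  have hIoc : ∫⁻ t in Ioi 0, ENNReal.ofReal (1 - G (t + a)) =
      ∫⁻ t in Ioc 0 (b - a), ENNReal.ofReal (1 - G (t + a)) := by
    rw [← Ioc_union_Ioi_eq_Ioi (sub_nonneg.2 hab),
      lintegral_union measurableSet_Ioi (Ioc_disjoint_Ioi le_rfl)]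
    have : ∫⁻ t in Ioi (b - a), ENNReal.ofReal (1 - G (t + a)) = ∫⁻ t in Ioi (b - a), 0 := by
      refine setLIntegral_congr_fun measurableSet_Ioi fun t ht => ?_
      have ht' : b - a < t := ht
      rw [h1 _ (by linarith), sub_self, ENNReal.ofReal_zero]
    rw [this, lintegral_zero, add_zero]
  have hint : IntervalIntegrable (fun t => 1 - G (t + a)) volume 0 (b - a) :=
    intervalIntegrable_const.sub hmono'.intervalIntegrable
  have hval : ∫⁻ t in Ioc 0 (b - a), ENNReal.ofReal (1 - G (t + a)) =
      ENNReal.ofReal (∫ x in a..b, (1 - G x)) := by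
    rw [← ofReal_integral_eq_lintegral_ofReal
      ((intervalIntegrable_iff_integrableOn_Ioc_of_le (sub_nonneg.2 hab)).1 hint)
      (Eventually.of_forall fun t => sub_nonneg.2 (hle _)),
      ← intervalIntegral.integral_of_le (sub_nonneg.2 hab),
      intervalIntegral.integral_comp_add_right (fun x => 1 - G x)]
    simp
  rw [lintegral_congr hsplit, lintegral_add_left measurable_const, lintegral_const,
    measure_univ, mul_one, htail, hIoc, hval,
    ENNReal.ofReal_add ha]
  exact intervalIntegral.integral_nonneg hab fun x _ => sub_nonneg.2 (hle x)

/-- The c.d.f. of the maximum of `n` i.i.d. variables. -/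
theorem pi_setOf_iSup_le {n : ℕ} [Nonempty (Fin n)] (μ : Measure ℝ) [SigmaFinite μ] (t : ℝ) :
    Measure.pi (fun _ : Fin n => μ) {x | ⨆ i, x i ≤ t} = μ (Iic t) ^ n := by
  have : {x : Fin n → ℝ | ⨆ i, x i ≤ t} = Set.pi univ fun _ => Iic t := by
    ext x
    simp [ciSup_le_iff (Set.finite_range x).bddAbove, Pi.le_def]
  rw [this, Measure.pi_pi, Finset.prod_const, Finset.card_univ, Fintype.card_fin]

theorem prophetMax_eq_lintegral {n : ℕ} [Nonempty (Fin n)] (ν : Fin n → Measure ℝ) :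
    prophetMax ν = ∫⁻ x, ENNReal.ofReal (⨆ i, x i) ∂(Measure.pi ν) := by
  refine lintegral_congr fun x => ?_
  exact (ENNReal.ofReal_mono.map_ciSup_of_continuousAt ENNReal.continuous_ofReal.continuousAt
    (Set.finite_range x).bddAbove).symm

namespace IsSolution

variable {β : ℝ} {y : ℝ → ℝ} {q : ℝ}

/-- One step of the dynamic program for boxes with law `law y q n`. -/
theorem lintegral_ofReal_max_law (h : IsSolution β y) (hβ : 0 < β) (hq : q ∈ Ioo (0 : ℝ) 1)
    {n : ℕ} (hn : 1 ≤ n) {a : ℝ} (ha : 0 ≤ a) (haH : a ≤ H y q) :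
    ∫⁻ x, ENNReal.ofReal (max x a) ∂(law y q n) =
      ENNReal.ofReal (a + ∫ x in a..H y q, (1 - F y q x ^ (1 / (n : ℝ)))) := by
  have hn' : (0 : ℝ) ≤ 1 / (n : ℝ) := by positivity
  have := (h.law_spec hβ hq hn).1
  refine lintegral_ofReal_max (h.law_spec hβ hq hn).2
    (fun a b hab => Real.rpow_le_rpow (h.F_mem_Icc hβ hq a).1 (h.monotone_F hβ hq hab) hn')
    (fun x => Real.rpow_nonneg (h.F_mem_Icc hβ hq x).1 _) (fun x hx => ?_) ha haH
  rw [h.F_of_H_le hβ hq hx, Real.one_rpow]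

/-- The `n`-th power cancels the root: the maximum has c.d.f. `F` whatever `n` is. -/
theorem prophetMax_law (h : IsSolution β y) (hβ : 0 < β) (hq : q ∈ Ioo (0 : ℝ) 1)
    {n : ℕ} (hn : 1 ≤ n) :
    prophetMax (fun _ : Fin n => law y q n) =
      ENNReal.ofReal (∫ x in (0 : ℝ)..H y q, (1 - F y q x)) := by
  have : Nonempty (Fin n) := ⟨⟨0, hn⟩⟩
  obtain ⟨hP, hcdf⟩ := h.law_spec hβ hq hn
  set P := Measure.pi fun _ : Fin n => law y q n
  have hmeas : Measurable fun x : Fin n → ℝ => ⨆ i, x i :=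
    Measurable.iSup fun i => measurable_pi_apply i
  have : IsProbabilityMeasure (P.map fun x => ⨆ i, x i) :=
    Measure.isProbabilityMeasure_map hmeas.aemeasurable
  have hmap : ∀ t, P.map (fun x => ⨆ i, x i) (Iic t) = ENNReal.ofReal (F y q t) := fun t => by
    rw [Measure.map_apply hmeas measurableSet_Iic]
    refine (pi_setOf_iSup_le _ t).trans ?_
    have hF := (h.F_mem_Icc hβ hq t).1
    rw [hcdf, ← ENNReal.ofReal_pow (Real.rpow_nonneg hF _), one_div,
      Real.rpow_inv_natCast_pow hF (by omega)]
  have key := lintegral_ofReal_max hmap (h.monotone_F hβ hq) (fun x => (h.F_mem_Icc hβ hq x).1)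
    (fun x hx => h.F_of_H_le hβ hq hx) le_rfl (h.H_pos hβ hq).le
  rw [zero_add] at key
  rw [prophetMax_eq_lintegral, ← key, lintegral_map (by fun_prop) hmeas]
  simp [P]

theorem integral_one_sub_F_pos (h : IsSolution β y) (hβ : 0 < β) (hq : q ∈ Ioo (0 : ℝ) 1) :
    0 < ∫ x in (0 : ℝ)..H y q, (1 - F y q x) := by
  refine intervalIntegral.intervalIntegral_pos_of_pos_on (h.intervalIntegrable_one_sub_F hβ hq _ _)
    (fun x hx => ?_) (h.H_pos hβ hq)
  rw [sub_pos, h.F_of_lt_H hβ hq hx.2]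
  refine h.lt_one hβ ⟨lt_max_of_lt_right (lt_min ?_ one_pos), clamp_le_one _⟩
  exact lt_max_of_lt_left hq.1

end IsSolution

/-! ### Optimal stopping of i.i.d. boxes by dynamic programming -/

/-- The optimal reward from `n` i.i.d. boxes with law `μ`. -/
def dpValue (μ : Measure ℝ) : ℕ → ENNReal
  | 0 => 0
  | n + 1 => ∫⁻ x, max (ENNReal.ofReal x) (dpValue μ n) ∂μ

/-- The reward of the rule that stops at step `k` on the event `S k`. -/
def stopReward {n : ℕ} (S : Fin n → Set (Fin n → ℝ)) (x : Fin n → ℝ) : ENNReal :=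
  ∑ k, (S k).indicator (fun x => ENNReal.ofReal (x k)) x

theorem measurable_stopReward {n : ℕ} {S : Fin n → Set (Fin n → ℝ)}
    (hS : ∀ k, MeasurableSet (S k)) : Measurable (stopReward S) := by
  unfold stopReward
  refine Finset.measurable_fun_sum _ fun k _ => Measurable.indicator ?_ (hS k)
  exact ENNReal.measurable_ofReal.comp (measurable_pi_apply k)

theorem measurable_cons {n : ℕ} (a : ℝ) :
    Measurable fun x : Fin n → ℝ => (Fin.cons a x : Fin (n + 1) → ℝ) :=
  measurable_pi_iff.2 fun i => by
    refine Fin.cases ?_ (fun j => ?_) i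
    · simp
    · simpa using measurable_pi_apply j

theorem lintegral_pi_succ {n : ℕ} (μ : Measure ℝ) [SigmaFinite μ]
    {f : (Fin (n + 1) → ℝ) → ENNReal} (hf : Measurable f) :
    ∫⁻ x, f x ∂(Measure.pi fun _ : Fin (n + 1) => μ) =
      ∫⁻ a, ∫⁻ x, f (Fin.cons a x) ∂(Measure.pi fun _ : Fin n => μ) ∂μ := by
  set e := MeasurableEquiv.piFinSuccAbove (fun _ : Fin (n + 1) => ℝ) 0
  have hMP := (measurePreserving_piFinSuccAbove (fun _ : Fin (n + 1) => μ) 0).symm e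
  rw [← hMP.lintegral_comp hf, lintegral_prod (fun z => f (e.symm z))
    (hf.comp e.symm.measurable).aemeasurable]
  refine lintegral_congr fun a => lintegral_congr fun x => ?_
  congr 1
  exact Fin.insertNth_zero' a x

theorem stopReward_cons {n : ℕ} (S : Fin (n + 1) → Set (Fin (n + 1) → ℝ)) (a : ℝ)
    (x : Fin n → ℝ) :
    stopReward S (Fin.cons a x) =
      (S 0).indicator (fun _ => ENNReal.ofReal a) (Fin.cons a x) +
        stopReward (fun k => {x | Fin.cons a x ∈ S k.succ}) x := by
  simp only [stopReward, Fin.sum_univ_succ]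
  congr 1

/-- The dynamic program bounds the reward of every selection rule from above. -/
theorem lintegral_stopReward_le (μ : Measure ℝ) [IsProbabilityMeasure μ] :
    ∀ {n : ℕ} (S : Fin n → Set (Fin n → ℝ)), (∀ k, MeasurableSet (S k)) →
      (∀ k l x, x ∈ S k → x ∈ S l → k = l) →
      (∀ k x x', (∀ j ≤ k, x j = x' j) → x ∈ S k → x' ∈ S k) →
      ∫⁻ x, stopReward S x ∂(Measure.pi fun _ : Fin n => μ) ≤ dpValue μ n := by
  intro n
  induction n with
  | zero => intro S _ _ _; simp [stopReward]
  | succ n ih =>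
    intro S hS hdisj hadap
    rw [lintegral_pi_succ μ (measurable_stopReward hS)]
    refine lintegral_mono fun a => ?_
    simp only [stopReward_cons]
    -- Stopping at step 0 depends on the first value `a` alone, so given `a` the rule stops there
    -- for every continuation or for none.
    by_cases h0 : ∃ x : Fin n → ℝ, (Fin.cons a x : Fin (n + 1) → ℝ) ∈ S 0
    · obtain ⟨x₀, hx₀⟩ := h0
      have hall : ∀ x : Fin n → ℝ, (Fin.cons a x : Fin (n + 1) → ℝ) ∈ S 0 := fun x =>
        hadap 0 _ _ (fun j hj => by
          rw [Fin.le_zero_iff] at hj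
          rw [hj, Fin.cons_zero, Fin.cons_zero]) hx₀
      have hz : ∀ x : Fin n → ℝ,
          stopReward (fun k => {x | (Fin.cons a x : Fin (n + 1) → ℝ) ∈ S k.succ}) x = 0 :=
        fun x => Finset.sum_eq_zero fun k _ => indicator_of_notMem
          (show x ∉ {x | (Fin.cons a x : Fin (n + 1) → ℝ) ∈ S k.succ} from
            fun hk => (Fin.succ_ne_zero k) (hdisj _ _ _ hk (hall x))) _
      simp [hz, hall]
    · push Not at h0
      simp only [indicator_of_notMem (h0 _), zero_add]
      refine (ih _ (fun k => (measurable_cons a) (hS _))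
        (fun k l x hk hl => Fin.succ_injective _ (hdisj _ _ _ hk hl))
        (fun k x x' hxx' hx => hadap _ _ _ (fun j hj => ?_) hx)).trans (le_max_right _ _)
      refine Fin.cases (fun _ => by simp) (fun i hi => ?_) j hj
      simpa using hxx' i (Fin.succ_le_succ_iff.1 hi)

/-- The event that step `k` is the first one whose value reaches the threshold. -/
def firstReach {n : ℕ} (θ : Fin n → ENNReal) (k : Fin n) : Set (Fin n → ℝ) :=
  {x | θ k ≤ ENNReal.ofReal (x k) ∧ ∀ j < k, ENNReal.ofReal (x j) < θ j}

theorem measurableSet_firstReach {n : ℕ} (θ : Fin n → ENNReal) (k : Fin n) :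
    MeasurableSet (firstReach θ k) := by
  have hm : ∀ j : Fin n, Measurable fun x : Fin n → ℝ => ENNReal.ofReal (x j) := fun j =>
    ENNReal.measurable_ofReal.comp (measurable_pi_apply j)
  have : firstReach θ k = {x | θ k ≤ ENNReal.ofReal (x k)} ∩
      ⋂ j, ⋂ _ : j < k, {x | ENNReal.ofReal (x j) < θ j} := by
    ext x; simp [firstReach]
  rw [this]
  exact (measurableSet_le measurable_const (hm k)).inter
    (MeasurableSet.iInter fun j => MeasurableSet.iInter fun _ =>
      measurableSet_lt (hm j) measurable_const)

/-- The thresholds given by the dynamic program. -/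
def dpThreshold (μ : Measure ℝ) (n : ℕ) (k : Fin n) : ENNReal := dpValue μ (n - 1 - k)

/-- Stopping exactly when the value reaches the continuation value turns the upper bound into an
equality. -/
theorem lintegral_stopReward_firstReach (μ : Measure ℝ) [IsProbabilityMeasure μ] (n : ℕ) :
    ∫⁻ x, stopReward (firstReach (dpThreshold μ n)) x ∂(Measure.pi fun _ : Fin n => μ) =
      dpValue μ n := by
  induction n with
  | zero => simp [stopReward, dpValue]
  | succ n ih =>
    rw [lintegral_pi_succ μ (measurable_stopReward (measurableSet_firstReach _))]
    refine lintegral_congr fun a => ?_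
    simp only [stopReward_cons]
    have hθ0 : dpThreshold μ (n + 1) 0 = dpValue μ n := by simp [dpThreshold]
    have hθs : ∀ k : Fin n, dpThreshold μ (n + 1) k.succ = dpThreshold μ n k := fun k => by
      simp only [dpThreshold, Fin.val_succ]
      congr 1
      omega
    have hmem0 : ∀ x : Fin n → ℝ, (Fin.cons a x : Fin (n + 1) → ℝ) ∈
        firstReach (dpThreshold μ (n + 1)) 0 ↔ dpValue μ n ≤ ENNReal.ofReal a := fun x => by
      simp [firstReach, hθ0]
    have hmems : ∀ (k : Fin n) (x : Fin n → ℝ), (Fin.cons a x : Fin (n + 1) → ℝ) ∈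
        firstReach (dpThreshold μ (n + 1)) k.succ ↔
          ENNReal.ofReal a < dpValue μ n ∧ x ∈ firstReach (dpThreshold μ n) k := fun k x => by
      simp only [firstReach, mem_ofPred_eq, Fin.cons_succ, hθs, Fin.forall_fin_succ,
        Fin.cons_zero, hθ0, Fin.succ_lt_succ_iff, Fin.succ_pos, true_imp_iff]
      tauto
    rcases le_or_gt (dpValue μ n) (ENNReal.ofReal a) with h | h
    · have hz : ∀ x : Fin n → ℝ, stopReward (fun k => {x | (Fin.cons a x : Fin (n + 1) → ℝ) ∈
          firstReach (dpThreshold μ (n + 1)) k.succ}) x = 0 :=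
        fun x => Finset.sum_eq_zero fun k _ => indicator_of_notMem
          (show x ∉ {x | (Fin.cons a x : Fin (n + 1) → ℝ) ∈
            firstReach (dpThreshold μ (n + 1)) k.succ} from
            fun hk => ((hmems k x).1 hk).1.not_ge h) _
      simp only [hz, indicator_of_mem ((hmem0 _).2 h), add_zero]
      simp [h]
    · have hnot : ∀ x : Fin n → ℝ, (Fin.cons a x : Fin (n + 1) → ℝ) ∉
          firstReach (dpThreshold μ (n + 1)) 0 := fun x hx => h.not_ge ((hmem0 x).1 hx)
      have hset : (fun k : Fin n => {x | (Fin.cons a x : Fin (n + 1) → ℝ) ∈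
          firstReach (dpThreshold μ (n + 1)) k.succ}) = firstReach (dpThreshold μ n) := by
        funext k
        ext x
        rw [mem_ofPred_eq, hmems]
        simp [h]
      simp only [indicator_of_notMem (hnot _), zero_add, hset, ih, max_eq_right h.le]

/-- The policy with the thresholds `θ`. -/
def thresholdPolicy {n : ℕ} (θ : Fin n → ENNReal) : Policy n where
  τ π x := Fin.find? fun k => decide (x ∘ π ∈ {z : Fin n → ℝ | θ k ≤ ENNReal.ofReal (z k)})
  measurableSet_stop π k := by
    have : {x : Fin n → ℝ | Fin.find? (fun k => decide (x ∘ π ∈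
        {z : Fin n → ℝ | θ k ≤ ENNReal.ofReal (z k)})) = some k} =
        (fun x => x ∘ π) ⁻¹' firstReach θ k := by
      ext x; simp [firstReach]
    rw [this]
    exact (measurable_pi_iff.2 fun i => measurable_pi_apply _) (measurableSet_firstReach θ k)
  nonanticipating k π π' x x' hxx' hx := by
    simp only [Fin.find?_eq_some_iff, mem_ofPred_eq, Function.comp_apply, decide_eq_true_eq,
      decide_eq_false_iff_not] at hx ⊢
    refine ⟨(hxx' k le_rfl).2 ▸ hx.1, fun j hj => (hxx' j hj.le).2 ▸ hx.2 j hj⟩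

theorem thresholdPolicy_τ_eq {n : ℕ} (θ : Fin n → ENNReal) (π : Equiv.Perm (Fin n))
    (x : Fin n → ℝ) (k : Fin n) :
    (thresholdPolicy θ).τ π x = some k ↔ x ∘ π ∈ firstReach θ k := by
  simp [thresholdPolicy, firstReach]

theorem Policy.ofReal_reward {n : ℕ} (T : Policy n) (π : Equiv.Perm (Fin n)) (x : Fin n → ℝ) :
    ENNReal.ofReal (T.reward π (x ∘ π.symm)) =
      stopReward (fun k => {x | T.τ π (x ∘ π.symm) = some k}) x := by
  unfold Policy.reward stopReward
  cases hτ : T.τ π (x ∘ π.symm) with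
  | none => simp [indicator, hτ]
  | some k => simp [indicator, hτ]

theorem measurable_comp_perm {n : ℕ} (π : Equiv.Perm (Fin n)) :
    Measurable fun x : Fin n → ℝ => x ∘ π :=
  measurable_pi_iff.2 fun i => measurable_pi_apply (π i)

/-- A product of equal laws is invariant under permutations, so values may be relabelled by order of
arrival. -/
theorem Policy.lintegral_reward {n : ℕ} (T : Policy n) (π : Equiv.Perm (Fin n)) (μ : Measure ℝ)
    [IsProbabilityMeasure μ] :
    ∫⁻ x, ENNReal.ofReal (T.reward π x) ∂(Measure.pi fun _ => μ) =
      ∫⁻ x, stopReward (fun k => {x | T.τ π (x ∘ π.symm) = some k}) x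
        ∂(Measure.pi fun _ => μ) := by
  set e := MeasurableEquiv.piCongrLeft (fun _ : Fin n => ℝ) π with he
  have hMP : MeasurePreserving e (Measure.pi fun _ => μ) (Measure.pi fun _ => μ) :=
    measurePreserving_piCongrLeft (α := fun _ : Fin n => ℝ) (μ := fun _ => μ) π
  have hcomp : ∀ x, e x = x ∘ π.symm := fun x => by
    funext i
    obtain ⟨j, rfl⟩ := π.surjective i
    rw [he, MeasurableEquiv.coe_piCongrLeft, Equiv.piCongrLeft_apply_apply]
    simp
  rw [← hMP.lintegral_comp_emb e.measurableEmbedding]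
  refine lintegral_congr fun x => ?_
  rw [hcomp, T.ofReal_reward]

/-- For each fixed order a policy becomes a stopping rule on i.i.d. values, so every term of the
average is at most the dynamic program's value; the threshold policy attains it in every term. -/
theorem opt_eq_dpValue (μ : Measure ℝ) [IsProbabilityMeasure μ] (n : ℕ) :
    opt (fun _ : Fin n => μ) = dpValue μ n := by
  have hc0 : (Fintype.card (Equiv.Perm (Fin n)) : ENNReal) ≠ 0 :=
    Nat.cast_ne_zero.2 Fintype.card_ne_zero
  have hct : (Fintype.card (Equiv.Perm (Fin n)) : ENNReal) ≠ ⊤ := ENNReal.natCast_ne_top _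
  refine le_antisymm (iSup_le fun T => ?_) (le_iSup_of_le (thresholdPolicy (dpThreshold μ n)) ?_)
  · refine ENNReal.div_le_of_le_mul ?_
    refine (Finset.sum_le_card_nsmul _ _ (dpValue μ n) fun π _ => ?_).trans_eq ?_
    · rw [T.lintegral_reward]
      refine lintegral_stopReward_le μ _
        (fun k => measurable_comp_perm π.symm (Policy.measurableSet_stop T π k))
        (fun k l x hk hl => ?_)
        fun k x x' hxx' hx => ?_
      · exact Option.some_injective _ (hk.symm.trans hl)
      · refine T.nonanticipating k π π _ _ (fun j hj => ⟨rfl, ?_⟩) hx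
        simpa using hxx' j hj
    · rw [nsmul_eq_mul, mul_comm, Finset.card_univ]
  · have hval : ∀ π : Equiv.Perm (Fin n), ∫⁻ x, ENNReal.ofReal
        ((thresholdPolicy (dpThreshold μ n)).reward π x) ∂(Measure.pi fun _ => μ) =
          dpValue μ n := fun π => by
      rw [Policy.lintegral_reward]
      have : (fun k => {x : Fin n → ℝ | (thresholdPolicy (dpThreshold μ n)).τ π (x ∘ π.symm) =
          some k}) = firstReach (dpThreshold μ n) := by
        funext k
        ext x
        rw [mem_ofPred_eq, thresholdPolicy_τ_eq]
        simp [Function.comp_assoc]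
      rw [this, lintegral_stopReward_firstReach]
    unfold Policy.value
    simp only [hval, Finset.sum_const, nsmul_eq_mul, Finset.card_univ]
    rw [mul_comm, ENNReal.mul_div_cancel_right hc0 hct]

/-! ### Convergence of the dynamic program to a differential equation -/

/-- `∫_a^H (1 - F^{1/n})`, the gain of one step of the dynamic program. -/
def gain (y : ℝ → ℝ) (q : ℝ) (n : ℕ) (a : ℝ) : ℝ :=
  ∫ x in a..H y q, (1 - F y q x ^ (1 / (n : ℝ)))

/-- `∫_a^H (-log F)`, the limit of `n * gain y q n a`. -/
def gainRate (y : ℝ → ℝ) (q : ℝ) (a : ℝ) : ℝ := ∫ x in a..H y q, -Real.log (F y q x)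

/-- The real values of the dynamic program for boxes with law `law y q n`. -/
def dpSeq (y : ℝ → ℝ) (q : ℝ) (n : ℕ) : ℕ → ℝ
  | 0 => 0
  | k + 1 => dpSeq y q n k + gain y q n (dpSeq y q n k)

/-- The solution of `v' = gainRate v`, `v(0) = 0`. -/
def path (y : ℝ → ℝ) (q s : ℝ) : ℝ :=
  if s ≤ 1 - q then threshold y (1 - s)
  else H y q - (H y q - threshold y q) * Real.exp ((s - (1 - q)) * Real.log (y q))

/-- This is `1 + u ≤ exp u` at `u = log z / n`. It makes the limit `-log F` its own dominating
function. -/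
theorem mul_one_sub_rpow_le_neg_log {z : ℝ} (hz : 0 < z) {n : ℕ} (hn : 1 ≤ n) :
    n * (1 - z ^ (1 / (n : ℝ))) ≤ -Real.log z := by
  have hn' : (0 : ℝ) < n := by exact_mod_cast hn
  have h := Real.add_one_le_exp (Real.log z * (1 / n))
  rw [Real.rpow_def_of_pos hz]
  have h2 : n * (1 - Real.exp (Real.log z * (1 / n))) ≤ n * (-(Real.log z * (1 / n))) :=
    mul_le_mul_of_nonneg_left (by linarith) hn'.le
  refine h2.trans_eq ?_
  field_simp

theorem tendsto_mul_one_sub_rpow {z : ℝ} (hz : 0 < z) :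
    Tendsto (fun n : ℕ => n * (1 - z ^ (1 / (n : ℝ)))) atTop (𝓝 (-Real.log z)) := by
  have hn : Tendsto (fun n : ℕ => 1 / (n : ℝ)) atTop (𝓝[>] 0) := by
    refine tendsto_nhdsWithin_iff.2 ⟨tendsto_one_div_atTop_nhds_zero_nat, ?_⟩
    filter_upwards [eventually_gt_atTop 0] with n hn
    have : (0 : ℝ) < n := by exact_mod_cast hn
    exact one_div_pos.2 this
  refine ((tendsto_rpow_sub_one_log hz).comp hn).neg.congr fun n => ?_
  simp only [Function.comp_apply, one_div, inv_inv]
  ring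

/-- Errors of an iteration with a nonexpansive map add up. -/
theorem abs_sub_le_sum_of_nonexpansive {a v δ : ℕ → ℝ} {Ψ : ℝ → ℝ} (h0 : a 0 = v 0)
    (ha : ∀ k, a (k + 1) = Ψ (a k)) {N : ℕ}
    (hΨ : ∀ k < N, |Ψ (a k) - Ψ (v k)| ≤ |a k - v k|)
    (hv : ∀ k < N, |Ψ (v k) - v (k + 1)| ≤ δ k) :
    |a N - v N| ≤ ∑ k ∈ Finset.range N, δ k := by
  induction N with
  | zero => simp [h0]
  | succ N ih =>
    rw [Finset.sum_range_succ, ha]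
    have h1 := ih (fun k hk => hΨ k (by omega)) (fun k hk => hv k (by omega))
    have h2 := abs_sub_le (Ψ (a N)) (Ψ (v N)) (v (N + 1))
    linarith [hΨ N (by omega), hv N (by omega)]

namespace IsSolution

variable {β : ℝ} {y : ℝ → ℝ} {q : ℝ}

theorem monotone_F_rpow (h : IsSolution β y) (hβ : 0 < β) (hq : q ∈ Ioo (0 : ℝ) 1) (n : ℕ) :
    Monotone fun x => F y q x ^ (1 / (n : ℝ)) := fun a _ hab =>
  Real.rpow_le_rpow (h.F_mem_Icc hβ hq a).1 (h.monotone_F hβ hq hab) (by positivity)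

theorem F_rpow_mem_Icc (h : IsSolution β y) (hβ : 0 < β) (hq : q ∈ Ioo (0 : ℝ) 1) (n : ℕ)
    (x : ℝ) : F y q x ^ (1 / (n : ℝ)) ∈ Icc (0 : ℝ) 1 :=
  ⟨Real.rpow_nonneg (h.F_mem_Icc hβ hq x).1 _,
    Real.rpow_le_one (h.F_mem_Icc hβ hq x).1 (h.F_mem_Icc hβ hq x).2 (by positivity)⟩

theorem intervalIntegrable_one_sub_F_rpow (h : IsSolution β y) (hβ : 0 < β)
    (hq : q ∈ Ioo (0 : ℝ) 1) (n : ℕ) (a b : ℝ) :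
    IntervalIntegrable (fun x => 1 - F y q x ^ (1 / (n : ℝ))) volume a b :=
  intervalIntegrable_const.sub (h.monotone_F_rpow hβ hq n).intervalIntegrable

theorem gain_sub_gain (h : IsSolution β y) (hβ : 0 < β) (hq : q ∈ Ioo (0 : ℝ) 1) (n : ℕ)
    {a b : ℝ} (hab : a ≤ b) : gain y q n a - gain y q n b ∈ Icc 0 (b - a) := by
  have hi := h.intervalIntegrable_one_sub_F_rpow hβ hq n
  have : gain y q n a - gain y q n b = ∫ x in a..b, (1 - F y q x ^ (1 / (n : ℝ))) := by
    rw [gain, gain, ← intervalIntegral.integral_add_adjacent_intervals (hi a b) (hi b _)]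
    ring
  rw [this]
  constructor
  · exact intervalIntegral.integral_nonneg hab fun x _ =>
      sub_nonneg.2 (h.F_rpow_mem_Icc hβ hq n x).2
  · have := intervalIntegral.integral_mono_on hab (hi a b) (intervalIntegrable_const (c := (1 : ℝ)))
      fun x _ => sub_le_self _ (h.F_rpow_mem_Icc hβ hq n x).1
    simpa using this

theorem gain_mem_Icc (h : IsSolution β y) (hβ : 0 < β) (hq : q ∈ Ioo (0 : ℝ) 1) (n : ℕ)
    {a : ℝ} (ha : a ≤ H y q) : gain y q n a ∈ Icc 0 (H y q - a) := by
  have := h.gain_sub_gain hβ hq n ha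
  have h0 : gain y q n (H y q) = 0 := by simp [gain]
  rwa [h0, sub_zero] at this

/-- The map `a ↦ a + gain a` has slope `F^{1/n}`, which lies in `[0, 1]`. -/
theorem abs_add_gain_sub_le (h : IsSolution β y) (hβ : 0 < β) (hq : q ∈ Ioo (0 : ℝ) 1) (n : ℕ)
    (a b : ℝ) : |(a + gain y q n a) - (b + gain y q n b)| ≤ |a - b| := by
  wlog hab : a ≤ b generalizing a b
  · rw [abs_sub_comm, abs_sub_comm a b]
    exact this b a (le_of_not_ge hab)
  have := h.gain_sub_gain hβ hq n hab
  rw [abs_of_nonpos (sub_nonpos.2 hab), abs_le]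
  constructor <;> linarith [this.1, this.2]

theorem dpSeq_spec (h : IsSolution β y) (hβ : 0 < β) (hq : q ∈ Ioo (0 : ℝ) 1) {n : ℕ}
    (hn : 1 ≤ n) (k : ℕ) :
    dpSeq y q n k ∈ Icc 0 (H y q) ∧
      dpValue (law y q n) k = ENNReal.ofReal (dpSeq y q n k) := by
  induction k with
  | zero => simp [dpSeq, dpValue, (h.H_pos hβ hq).le]
  | succ k ih =>
    obtain ⟨hmem, hval⟩ := ih
    have hg := h.gain_mem_Icc hβ hq n hmem.2
    refine ⟨⟨add_nonneg hmem.1 hg.1, ?_⟩, ?_⟩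
    · simp only [dpSeq]; linarith [hg.2]
    · simp only [dpValue, dpSeq, hval]
      rw [gain, ← h.lintegral_ofReal_max_law hβ hq hn hmem.1 hmem.2]
      exact lintegral_congr fun x => (ENNReal.ofReal_max x _).symm

/-- The total error in the approximation of `-log F` by `n (1 - F^{1/n})`. -/
theorem tendsto_integral_neg_log_F_sub (h : IsSolution β y) (hβ : 0 < β)
    (hq : q ∈ Ioo (0 : ℝ) 1) :
    Tendsto (fun n : ℕ => gainRate y q 0 - n * gain y q n 0) atTop (𝓝 0) := by
  have hH := h.H_pos hβ hq
  have key : Tendsto (fun n : ℕ => ∫ x in (0 : ℝ)..H y q, n * (1 - F y q x ^ (1 / (n : ℝ))))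
      atTop (𝓝 (gainRate y q 0)) := by
    refine intervalIntegral.tendsto_integral_filter_of_dominated_convergence
      (fun x => -Real.log (F y q x)) ?_ ?_ (h.intervalIntegrable_neg_log_F hβ hq) ?_
    · refine Eventually.of_forall fun n => ?_
      exact (measurable_const.mul (measurable_const.sub
        (h.monotone_F_rpow hβ hq n).measurable)).aestronglyMeasurable
    · filter_upwards [eventually_ge_atTop 1] with n hn
      refine Eventually.of_forall fun x hx => ?_
      rw [uIoc_of_le hH.le] at hx
      rw [Real.norm_of_nonneg
        (mul_nonneg n.cast_nonneg (sub_nonneg.2 (h.F_rpow_mem_Icc hβ hq n x).2))]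
      exact mul_one_sub_rpow_le_neg_log (h.F_pos hβ hq hx.1) hn
    · refine Eventually.of_forall fun x hx => ?_
      rw [uIoc_of_le hH.le] at hx
      exact tendsto_mul_one_sub_rpow (h.F_pos hβ hq hx.1)
  have := (tendsto_const_nhds (x := gainRate y q 0)).sub key
  rw [sub_self] at this
  refine this.congr fun n => ?_
  rw [intervalIntegral.integral_const_mul, gain]

theorem intervalIntegrable_neg_log_F_of_mem (h : IsSolution β y) (hβ : 0 < β)
    (hq : q ∈ Ioo (0 : ℝ) 1) {a b : ℝ} (ha : a ∈ Icc 0 (H y q)) (hb : b ∈ Icc 0 (H y q)) :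
    IntervalIntegrable (fun x => -Real.log (F y q x)) volume a b := by
  refine (h.intervalIntegrable_neg_log_F hβ hq).mono_set ?_
  rw [uIcc_of_le (h.H_pos hβ hq).le]
  exact uIcc_subset_Icc ha hb

theorem antitoneOn_gainRate (h : IsSolution β y) (hβ : 0 < β) (hq : q ∈ Ioo (0 : ℝ) 1) :
    AntitoneOn (gainRate y q) (Icc 0 (H y q)) := by
  intro a ha b hb hab
  have hi := fun {a b} => h.intervalIntegrable_neg_log_F_of_mem hβ hq (a := a) (b := b)
  have hH : H y q ∈ Icc 0 (H y q) := ⟨(h.H_pos hβ hq).le, le_rfl⟩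
  rw [gainRate, gainRate, ← intervalIntegral.integral_add_adjacent_intervals (hi ha hb) (hi hb hH)]
  have := intervalIntegral.integral_nonneg hab (μ := volume)
    fun x _ => h.neg_log_F_nonneg hβ hq x
  linarith

theorem gainRate_nonneg (h : IsSolution β y) (hβ : 0 < β) (hq : q ∈ Ioo (0 : ℝ) 1) {a : ℝ}
    (ha : a ≤ H y q) : 0 ≤ gainRate y q a :=
  intervalIntegral.integral_nonneg ha fun x _ => h.neg_log_F_nonneg hβ hq x

/-- The integrand of the difference is nonnegative for positive arguments, so the error at 0
dominates the error at every `a`. -/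
theorem gainRate_sub_gain_mem_Icc (h : IsSolution β y) (hβ : 0 < β) (hq : q ∈ Ioo (0 : ℝ) 1)
    {n : ℕ} (hn : 1 ≤ n) {a : ℝ} (ha : a ∈ Icc 0 (H y q)) :
    gainRate y q a - n * gain y q n a ∈ Icc 0 (gainRate y q 0 - n * gain y q n 0) := by
  have hH : H y q ∈ Icc 0 (H y q) := ⟨(h.H_pos hβ hq).le, le_rfl⟩
  have hi : ∀ {a}, a ∈ Icc 0 (H y q) → IntervalIntegrable
      (fun x => -Real.log (F y q x) - n * (1 - F y q x ^ (1 / (n : ℝ)))) volume a (H y q) :=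
    fun ha => (h.intervalIntegrable_neg_log_F_of_mem hβ hq ha hH).sub
      ((h.intervalIntegrable_one_sub_F_rpow hβ hq n _ _).const_mul _)
  have heq : ∀ {a}, a ∈ Icc 0 (H y q) → gainRate y q a - n * gain y q n a =
      ∫ x in a..H y q, (-Real.log (F y q x) - n * (1 - F y q x ^ (1 / (n : ℝ)))) := fun ha => by
    rw [intervalIntegral.integral_sub (h.intervalIntegrable_neg_log_F_of_mem hβ hq ha hH)
      ((h.intervalIntegrable_one_sub_F_rpow hβ hq n _ _).const_mul _),
      intervalIntegral.integral_const_mul, gainRate, gain]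
  have h0 : (0 : ℝ) ∈ Icc 0 (H y q) := ⟨le_rfl, hH.1⟩
  have hnn : ∀ x, 0 < x → 0 ≤ -Real.log (F y q x) - n * (1 - F y q x ^ (1 / (n : ℝ))) :=
    fun x hx => sub_nonneg.2 (mul_one_sub_rpow_le_neg_log (h.F_pos hβ hq hx) hn)
  rw [heq ha, heq h0]
  constructor
  · refine intervalIntegral.integral_nonneg_of_ae_restrict ha.2 ?_
    -- The point `x = 0` must be discarded: there `F` vanishes and `Real.log 0 = 0`, so the
    -- integrand is `-n`.
    rw [← restrict_Ioc_eq_restrict_Icc]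
    filter_upwards [ae_restrict_mem measurableSet_Ioc] with x hx
    exact hnn x (ha.1.trans_lt hx.1)
  · refine intervalIntegral.integral_mono_interval ha.1 ha.2 le_rfl ?_ (hi h0)
    filter_upwards [ae_restrict_mem measurableSet_Ioc] with x hx
    exact hnn x hx.1

/-! #### The limiting path -/

theorem path_of_ge {s : ℝ} (hs : 1 - q ≤ s) :
    path y q s =
      H y q - (H y q - threshold y q) * Real.exp ((s - (1 - q)) * Real.log (y q)) := by
  rw [path]
  split_ifs with h1
  · have : s = 1 - q := le_antisymm h1 hs
    subst this
    simp
  · rfl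

theorem path_zero (hq : q ∈ Ioo (0 : ℝ) 1) : path y q 0 = 0 := by
  rw [path, if_pos (by linarith [hq.2]), sub_zero, threshold_one]

theorem continuous_path (h : IsSolution β y) (hβ : 0 < β) : Continuous (path y q) := by
  unfold path
  refine Continuous.if_le ((h.continuous_threshold hβ).comp (by fun_prop)) (by fun_prop)
    continuous_id continuous_const fun s hs => ?_
  subst hs
  simp

theorem path_mem_Icc (h : IsSolution β y) (hβ : 0 < β) (hq : q ∈ Ioo (0 : ℝ) 1) {s : ℝ}
    (hs : s ∈ Icc (0 : ℝ) 1) : path y q s ∈ Icc 0 (H y q) := by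
  have hH := h.threshold_lt_H hβ hq
  rcases le_total s (1 - q) with h1 | h1
  · rw [path, if_pos h1]
    refine ⟨h.threshold_nonneg hβ (by linarith [hs.1]), le_trans ?_ hH.le⟩
    exact (h.strictAnti_threshold hβ).antitone (by linarith)
  · rw [path_of_ge h1]
    have he : Real.exp ((s - (1 - q)) * Real.log (y q)) ≤ 1 :=
      Real.exp_le_one_iff.2 (mul_nonpos_of_nonneg_of_nonpos (by linarith) (h.log_neg hβ hq).le)
    have h0 := h.threshold_nonneg hβ hq.2.le
    have hpos := Real.exp_pos ((s - (1 - q)) * Real.log (y q))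
    constructor
    · nlinarith
    · have : 0 ≤ (H y q - threshold y q) * Real.exp ((s - (1 - q)) * Real.log (y q)) :=
        mul_nonneg (by linarith) hpos.le
      linarith

/-- Right derivatives are enough for the comparison arguments below and spare matching both branches
at `s = 1 - q`. The late branch solves `v' = (H - v)(-log p)`. -/
theorem hasDerivWithinAt_path (h : IsSolution β y) (hβ : 0 < β) (hq : q ∈ Ioo (0 : ℝ) 1) {s : ℝ}
    (hs : s ∈ Ico (0 : ℝ) 1) :
    HasDerivWithinAt (path y q) (gainRate y q (path y q s)) (Ici s) s := by
  have hH := h.threshold_lt_H hβ hq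
  rcases lt_or_ge s (1 - q) with h1 | h1
  · have hd : HasDerivAt (fun s => threshold y (1 - s)) (speed y (1 - s))⁻¹ s := by
      refine ((h.hasDerivAt_threshold hβ (1 - s)).comp s
        ((hasDerivAt_id s).const_sub 1)).congr_deriv ?_
      ring
    have hev : path y q =ᶠ[𝓝 s] fun s => threshold y (1 - s) := by
      filter_upwards [Iio_mem_nhds h1] with z hz
      rw [path, if_pos (le_of_lt hz)]
    rw [hev.eq_of_nhds, gainRate, h.integral_neg_log_F hβ hq ⟨by linarith, by linarith [hs.1]⟩]
    exact (hd.congr_of_eventuallyEq hev).hasDerivWithinAt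
  · have hmem : path y q s ∈ Icc (threshold y q) (H y q) := by
      refine ⟨?_, (h.path_mem_Icc hβ hq ⟨hs.1, hs.2.le⟩).2⟩
      rw [path_of_ge h1]
      have he : Real.exp ((s - (1 - q)) * Real.log (y q)) ≤ 1 :=
        Real.exp_le_one_iff.2 (mul_nonpos_of_nonneg_of_nonpos (by linarith) (h.log_neg hβ hq).le)
      nlinarith
    rw [gainRate, (h.integral_neg_log_F_const hβ hq hmem).2, path_of_ge h1]
    have hd : HasDerivAt (fun s => H y q - (H y q - threshold y q) *
        Real.exp ((s - (1 - q)) * Real.log (y q)))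
        ((H y q - threshold y q) * Real.exp ((s - (1 - q)) * Real.log (y q)) *
          -Real.log (y q)) s := by
      refine (((((hasDerivAt_id s).sub_const (1 - q)).mul_const (Real.log (y q))).exp.const_mul
        (H y q - threshold y q)).const_sub (H y q)).congr_deriv ?_
      simp only [id]
      ring
    refine (hd.hasDerivWithinAt.congr (fun z hz => path_of_ge (h1.trans hz))
      (path_of_ge h1)).congr_deriv ?_
    ring

theorem monotoneOn_path (h : IsSolution β y) (hβ : 0 < β) (hq : q ∈ Ioo (0 : ℝ) 1) :
    MonotoneOn (path y q) (Icc 0 1) := by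
  intro a ha b hb hab
  exact image_le_of_deriv_right_le_deriv_boundary (f := fun _ => path y q a) (f' := fun _ => 0)
    (B := path y q) (B' := fun s => gainRate y q (path y q s)) continuousOn_const
    (fun x _ => hasDerivWithinAt_const _ _ _) le_rfl (h.continuous_path hβ).continuousOn
    (fun x hx => h.hasDerivWithinAt_path hβ hq ⟨ha.1.trans hx.1, hx.2.trans_le hb.2⟩)
    (fun x hx => h.gainRate_nonneg hβ hq
      (h.path_mem_Icc hβ hq ⟨ha.1.trans hx.1, hx.2.le.trans hb.2⟩).2) ⟨hab, le_rfl⟩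

/-- The rate decreases along the increasing path, so the path is compared with the two lines through
its left endpoint having the final and the initial rate as slopes. -/
theorem path_sub_path_mem_Icc (h : IsSolution β y) (hβ : 0 < β) (hq : q ∈ Ioo (0 : ℝ) 1)
    {a b : ℝ} (ha : 0 ≤ a) (hab : a ≤ b) (hb : b ≤ 1) :
    path y q b - path y q a ∈
      Icc ((b - a) * gainRate y q (path y q b)) ((b - a) * gainRate y q (path y q a)) := by
  have hlin : ∀ c x : ℝ, HasDerivWithinAt (fun z => path y q a + (z - a) * c) c (Ici x) x :=
    fun c x => by
      refine ((((hasDerivAt_id x).sub_const a).mul_const c).const_add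
        (path y q a)).hasDerivWithinAt.congr_deriv ?_
      ring
  have hmem : ∀ {x}, x ∈ Icc a b → x ∈ Icc (0 : ℝ) 1 := fun hx =>
    ⟨ha.trans hx.1, hx.2.trans hb⟩
  have hanti : ∀ {s t}, s ∈ Icc a b → t ∈ Icc a b → s ≤ t →
      gainRate y q (path y q t) ≤ gainRate y q (path y q s) := fun hs ht hst =>
    h.antitoneOn_gainRate hβ hq (h.path_mem_Icc hβ hq (hmem hs)) (h.path_mem_Icc hβ hq (hmem ht))
      (h.monotoneOn_path hβ hq (hmem hs) (hmem ht) hst)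
  have hpd : ∀ x ∈ Ico a b, HasDerivWithinAt (path y q) (gainRate y q (path y q x)) (Ici x) x :=
    fun x hx => h.hasDerivWithinAt_path hβ hq ⟨ha.trans hx.1, hx.2.trans_le hb⟩
  have hpc := (h.continuous_path (q := q) hβ).continuousOn (s := Icc a b)
  constructor
  · have := image_le_of_deriv_right_le_deriv_boundary
      (f := fun z => path y q a + (z - a) * gainRate y q (path y q b)) (by fun_prop)
      (fun x _ => hlin _ x) (by simp) hpc hpd
      (fun x hx => hanti ⟨hx.1, hx.2.le⟩ ⟨hab, le_rfl⟩ hx.2.le) ⟨hab, le_rfl⟩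
    linarith
  · have := image_le_of_deriv_right_le_deriv_boundary
      (B := fun z => path y q a + (z - a) * gainRate y q (path y q a)) hpc hpd (by simp)
      (by fun_prop) (fun x _ => hlin _ x)
      (fun x hx => hanti ⟨le_rfl, hab⟩ ⟨hx.1, hx.2.le⟩ hx.1) ⟨hab, le_rfl⟩
    linarith

theorem abs_dpSeq_sub_path_le (h : IsSolution β y) (hβ : 0 < β) (hq : q ∈ Ioo (0 : ℝ) 1) {n : ℕ}
    (hn : 1 ≤ n) :
    |dpSeq y q n n - path y q 1| ≤
      (gainRate y q 0 - n * gain y q n 0) + gainRate y q 0 * (1 / (n : ℝ)) := by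
  have hn' : (0 : ℝ) < n := by exact_mod_cast hn
  set ε := gainRate y q 0 - n * gain y q n 0 with hε
  set u : ℕ → ℝ := fun k => gainRate y q (path y q (k / n)) with hu
  -- In `δ`, `ε` accounts for replacing `n (1 - F^{1/n})` by `-log F`, and `u k - u (k + 1)` for the
  -- change of rate during one step; the latter telescopes.
  have key := abs_sub_le_sum_of_nonexpansive (a := dpSeq y q n)
    (v := fun k : ℕ => path y q (k / n)) (δ := fun k => (ε + (u k - u (k + 1))) / n)
    (Ψ := fun a => a + gain y q n a) (N := n) (by simp [dpSeq, path_zero hq]) (fun k => rfl)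
    (fun k _ => h.abs_add_gain_sub_le hβ hq n _ _) fun k hk => ?_
  · simp only [div_self hn'.ne'] at key
    refine key.trans ?_
    rw [← Finset.sum_div, Finset.sum_add_distrib, Finset.sum_range_sub', Finset.sum_const,
      Finset.card_range, nsmul_eq_mul]
    have hun : 0 ≤ u n := by
      simp only [hu, div_self hn'.ne']
      exact h.gainRate_nonneg hβ hq (h.path_mem_Icc hβ hq ⟨zero_le_one, le_rfl⟩).2
    have hu0 : u 0 = gainRate y q 0 := by simp [hu, path_zero hq]
    rw [div_le_iff₀ hn', hu0]
    have : (ε + gainRate y q 0 * (1 / n)) * n = n * ε + gainRate y q 0 := by field_simp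
    linarith
  · have hk1 : ((k + 1 : ℕ) : ℝ) / n ≤ 1 := by
      rw [div_le_one hn']; exact_mod_cast hk
    have hk0 : (0 : ℝ) ≤ (k : ℝ) / n := by positivity
    have hstep : ((k + 1 : ℕ) : ℝ) / n - k / n = 1 / n := by push_cast; ring
    have hle : (k : ℝ) / n ≤ ((k + 1 : ℕ) : ℝ) / n := by
      have : (0 : ℝ) < 1 / n := by positivity
      linarith
    have h1 := h.path_sub_path_mem_Icc hβ hq hk0 hle hk1
    have h2 := h.gainRate_sub_gain_mem_Icc hβ hq hn (h.path_mem_Icc hβ hq ⟨hk0, hle.trans hk1⟩)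
    rw [hstep] at h1
    set g := gain y q n (path y q (k / n))
    change 1 / n * u (k + 1) ≤ _ ∧ _ ≤ 1 / n * u k at h1
    change 0 ≤ u k - n * g ∧ u k - n * g ≤ ε at h2
    have h3 : (u k - n * g) / n = 1 / n * u k - g := by field_simp
    have h4 : 0 ≤ (u k - n * g) / n := div_nonneg h2.1 hn'.le
    have h5 : (u k - n * g) / n ≤ ε / n := div_le_div_of_nonneg_right h2.2 hn'.le
    have h6 : (ε + (u k - u (k + 1))) / n = ε / n + (1 / n * u k - 1 / n * u (k + 1)) := by
      ring
    rw [h6, abs_le]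
    constructor <;> linarith [h1.1, h1.2]

theorem tendsto_opt (h : IsSolution β y) (hβ : 0 < β) (hq : q ∈ Ioo (0 : ℝ) 1) :
    Tendsto (fun n : ℕ => opt (fun _ : Fin n => law y q n)) atTop
      (𝓝 (ENNReal.ofReal (path y q 1))) := by
  have hlim : Tendsto (fun n : ℕ => dpSeq y q n n) atTop (𝓝 (path y q 1)) := by
    rw [tendsto_iff_dist_tendsto_zero]
    have hb : Tendsto (fun n : ℕ => (gainRate y q 0 - n * gain y q n 0) +
        gainRate y q 0 * (1 / (n : ℝ))) atTop (𝓝 0) := by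
      simpa using (h.tendsto_integral_neg_log_F_sub hβ hq).add
        (tendsto_one_div_atTop_nhds_zero_nat.const_mul (gainRate y q 0))
    refine squeeze_zero' (Eventually.of_forall fun _ => dist_nonneg) ?_ hb
    filter_upwards [eventually_ge_atTop 1] with n hn
    exact h.abs_dpSeq_sub_path_le hβ hq hn
  refine (ENNReal.tendsto_ofReal hlim).congr' ?_
  filter_upwards [eventually_ge_atTop 1] with n hn
  have := (h.law_spec hβ hq hn).1
  rw [opt_eq_dpValue, (h.dpSeq_spec hβ hq hn n).2]

end IsSolution

/-! ### The limit `q → 0` -/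

namespace IsSolution

variable {β : ℝ} {y : ℝ → ℝ}

theorem tendsto_y_nhdsGT_zero (h : IsSolution β y) : Tendsto y (𝓝[>] 0) (𝓝 1) := by
  have h1 := (h.continuousOn 0 (by simp)).mono (Ioo_subset_Icc_self)
  rw [ContinuousWithinAt, h.zero, nhdsWithin_Ioo_eq_nhdsGT zero_lt_one] at h1
  exact h1

theorem H_sub_threshold (y : ℝ → ℝ) {q : ℝ} (hq : q ∈ Ioo (0 : ℝ) 1) :
    H y q - threshold y q = (speed y q)⁻¹ / -Real.log (y q) := by
  rw [H_eq y ⟨hq.1.le, hq.2.le⟩, add_sub_cancel_left, one_div, mul_inv, div_eq_mul_inv]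

theorem path_one (y : ℝ → ℝ) {q : ℝ} (hq : q ∈ Ioo (0 : ℝ) 1) :
    path y q 1 = threshold y q +
      (speed y q)⁻¹ * ((1 - Real.exp (q * Real.log (y q))) / -Real.log (y q)) := by
  rw [path_of_ge (by linarith [hq.1]), sub_sub_cancel]
  linear_combination (1 - Real.exp (q * Real.log (y q))) * H_sub_threshold y hq

theorem tendsto_threshold (h : IsSolution β y) (hβ : 0 < β) :
    Tendsto (threshold y) (𝓝[>] 0) (𝓝 (threshold y 0)) :=
  (h.continuous_threshold hβ).continuousAt.continuousWithinAt

theorem tendsto_inv_speed (h : IsSolution β y) (hβ : 0 < β) :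
    Tendsto (fun q => (speed y q)⁻¹) (𝓝[>] 0) (𝓝 β) := by
  have := ((h.continuous_inv_speed hβ).continuousAt (x := 0)).continuousWithinAt (s := Ioi 0)
  rwa [ContinuousWithinAt, h.speed_zero hβ, inv_inv] at this

/-- The contribution of the last stretch of time, of length `q`, vanishes because `0 ≤ (1 - p^q) /
(-log p) ≤ q`. -/
theorem tendsto_path_one (h : IsSolution β y) (hβ : 0 < β) :
    Tendsto (fun q => path y q 1) (𝓝[>] 0) (𝓝 (threshold y 0)) := by
  have h1 : Tendsto (fun q => (1 - Real.exp (q * Real.log (y q))) / -Real.log (y q))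
      (𝓝[>] 0) (𝓝 0) := by
    have hid : Tendsto (fun q : ℝ => q) (𝓝[>] 0) (𝓝 0) := nhdsWithin_le_nhds
    refine squeeze_zero' ?_ ?_ hid
    · filter_upwards [Ioo_mem_nhdsGT zero_lt_one] with q hq
      have hl := h.log_neg hβ hq
      refine div_nonneg (sub_nonneg.2 (Real.exp_le_one_iff.2 ?_)) (by linarith)
      exact mul_nonpos_of_nonneg_of_nonpos hq.1.le hl.le
    · filter_upwards [Ioo_mem_nhdsGT zero_lt_one] with q hq
      have hl := h.log_neg hβ hq
      rw [div_le_iff₀ (by linarith)]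
      have := Real.add_one_le_exp (q * Real.log (y q))
      linarith
  have h2 := (h.tendsto_threshold hβ).add ((h.tendsto_inv_speed hβ).mul h1)
  rw [mul_zero, add_zero] at h2
  refine h2.congr' ?_
  filter_upwards [Ioo_mem_nhdsGT zero_lt_one] with q hq
  exact (path_one y hq).symm

/-- `H` escapes to infinity while the atom's mass `1 - p` vanishes; since `(1 - p) / (-log p) → 1`,
their product contributes `β` and cancels the limit of `-y/speed`. -/
theorem tendsto_integral_one_sub_F (h : IsSolution β y) (hβ : 0 < β) :
    Tendsto (fun q => ∫ x in (0 : ℝ)..H y q, (1 - F y q x)) (𝓝[>] 0) (𝓝 (threshold y 0 / β)) := by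
  have hy := h.tendsto_y_nhdsGT_zero
  have h1 : Tendsto (fun q => (1 - y q) / -Real.log (y q)) (𝓝[>] 0) (𝓝 1) := by
    refine tendsto_of_tendsto_of_tendsto_of_le_of_le' hy tendsto_const_nhds ?_ ?_
    · filter_upwards [Ioo_mem_nhdsGT zero_lt_one] with q hq
      have hl := h.log_neg hβ hq
      have hp := h.pos hβ ⟨hq.1.le, hq.2⟩
      rw [le_div_iff₀ (by linarith)]
      have h2 := mul_le_mul_of_nonneg_left (Real.one_sub_inv_le_log_of_pos hp) hp.le
      have h3 : y q * (1 - (y q)⁻¹) = y q - 1 := by field_simp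
      linarith
    · filter_upwards [Ioo_mem_nhdsGT zero_lt_one] with q hq
      have hl := h.log_neg hβ hq
      have hp := h.pos hβ ⟨hq.1.le, hq.2⟩
      rw [div_le_one (by linarith)]
      linarith [Real.log_le_sub_one_of_pos hp]
  have h2 := (((h.tendsto_threshold hβ).div_const β).sub
    (hy.mul (h.tendsto_inv_speed hβ))).add ((h.tendsto_inv_speed hβ).mul h1)
  rw [one_mul, mul_one, sub_add_cancel] at h2
  refine h2.congr' ?_
  filter_upwards [Ioo_mem_nhdsGT zero_lt_one] with q hq
  rw [h.integral_one_sub_F hβ hq, H_sub_threshold y hq]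
  ring

end IsSolution

end

end Prophet

theorem theorem3p8 :
    (∃! β : ℝ, Prophet.IsKertzConstant β) ∧
    ∀ β : ℝ, Prophet.IsKertzConstant β →
      (∃ y : ℝ → ℝ, Prophet.IsSolution β y) ∧
      ∀ y : ℝ → ℝ, Prophet.IsSolution β y →
        (∀ q ∈ Ioo (0 : ℝ) 1, ∀ n : ℕ, 1 ≤ n →
          IsProbabilityMeasure (Prophet.law y q n) ∧
          ∀ x : ℝ, (Prophet.law y q n).real (Iic x) = Prophet.F y q x ^ (1 / (n : ℝ))) ∧
        ∃ OPT MAX : ℝ → ℝ,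
          (∀ q ∈ Ioo (0 : ℝ) 1,
            0 ≤ OPT q ∧ 0 < MAX q ∧
            Tendsto (fun n : ℕ => Prophet.opt (fun _ : Fin n => Prophet.law y q n)) atTop
              (𝓝 (ENNReal.ofReal (OPT q))) ∧
            ∀ n : ℕ, 1 ≤ n →
              Prophet.prophetMax (fun _ : Fin n => Prophet.law y q n) =
                ENNReal.ofReal (MAX q)) ∧
          Tendsto (fun q : ℝ => OPT q / MAX q) (𝓝[>] 0) (𝓝 β) := by
  refine ⟨Prophet.existsUnique_isKertzConstant, fun β hK => ⟨hK.exists_isSolution, fun y h => ?_⟩⟩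
  have hβ := hK.1
  refine ⟨fun q hq n hn => ⟨(h.law_spec hβ hq hn).1, h.law_real_Iic hβ hq hn⟩,
    fun q => Prophet.path y q 1, fun q => ∫ x in (0 : ℝ)..Prophet.H y q, (1 - Prophet.F y q x),
    fun q hq => ⟨(h.path_mem_Icc hβ hq ⟨zero_le_one, le_rfl⟩).1, h.integral_one_sub_F_pos hβ hq,
      h.tendsto_opt hβ hq, fun n hn => h.prophetMax_law hβ hq hn⟩, ?_⟩
  have h0 := h.threshold_pos hβ zero_lt_one
  -- The numerator tends to `r(0)` and the denominator to `r(0)/β`, with `r(0) > 0`.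
  have key := (h.tendsto_path_one hβ).div (h.tendsto_integral_one_sub_F hβ) (by positivity)
  have hval : Prophet.threshold y 0 / (Prophet.threshold y 0 / β) = β := by field_simp
  rwa [hval] at key
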